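/- Let $N\ge 1$, $T>0$, and for $i=1,\dots,N$ let $l_i>0$, $D_i>0$, $Q_i=(0,l_i)\times(0,T)$. Set $\mathbb L^2=\prod_i L^2(0,l_i)$ with scalar product $(\rho,\varphi)=\sum_i\int_0^{l_i}\rho_i\varphi_i\,dx$, $\mathbb L^\infty=\prod_i L^\infty(Q_i)$ with norm $\|u\|=\sum_i\|u_i\|_{L^\infty(Q_i)}$, and $\mathbb H^1=\prod_i H^1(0,l_i)$ with norm $(\sum_i\|\varphi_i\|_{H^1(0,l_i)}^2)^{1/2}$. Let $$\mathbb V=\{\varphi\in\mathbb H^1:\ \varphi_i(0)=\varphi_j(0),\ \varphi_i(l_i)=0\ \text{ for all } i,j\},$$ with the norm of $\mathbb H^1$, let $\mathbb V\hookrightarrow\mathbb L^2\hookrightarrow\mathbb V^\star$ through the scalar product of $\mathbb L^2$, and let $$\mathbb W(0,T)=\{\rho\in L^2(0,T;\mathbb V):\ \rho_t\in L^2(0,T;\mathbb V^\star)\},\qquad \|\rho\|_{\mathbb W(0,T)}^2=\|\rho\|_{L^2(0,T;\mathbb V)}^2+\|\rho_t\|_{L^2(0,T;\mathbb V^\star)}^2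 .$$ Values $\rho(\cdot,0)$ of $\rho\in\mathbb W(0,T)$ are those of its representative in $\mathcal C([0,T];\mathbb L^2)$. For $u\in\mathbb L^\infty$ and $\rho,\varphi\in\mathbb V$ put, for a.e. $t$, $$\mathcal F[u](\rho,\varphi)=\sum_{i=1}^N\int_0^{l_i}\bigl(D_i\,\partial_x\rho_i+u_i(\cdot,t)\rho_i\bigr)\,\partial_x\varphi_i\,dx .$$ Fix $\rho^0\in\mathbb L^2$. For every $u\in\mathbb L^\infty$ there is a unique $\rho=:G(u)\in\mathbb W(0,T)$ such that $\frac{d}{dt}(\rho(\cdot),\varphi)+\mathcal F[u](\rho(\cdot),\varphi)=0$ in $\mathcal D'(0,T)$ for all $\varphi\in\mathbb V$ and $\rho(\cdot,0)=\rho^0$ in $\mathbb L^2$ (the weak solution of the Fokker–Planck problem with drift $u$ on the star graph with edges $(0,l_i)$). The control-to-state map $G:\mathbb L^\infty\to\mathbb W(0,T)$ so defined is Fréchet differentiable at every $u\in\mathbb L^\infty$, and for all $u,v\in\mathbb L^\infty$, with $\rho=G(u)$, its derivative is $G'(u)v=z_v$, where $z_v$ is the unique $z\in\mathbb W(0,T)$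 with $$\langle z_t,\cdot\rangle+\mathcal F[u](z,\cdot)=d[\rho v]\ \text{ in } L^2(0,T;\mathbb V^\star),\qquad z(\cdot,0)=0\ \text{ in }\mathbb L^2 .$$ Here $\rho v=(\rho_iv_i)_i$ and, for a.e. $t$, $d[\rho v](t)\in\mathbb V^\star$ is the functional $\varphi\mapsto-\sum_{i=1}^N\int_0^{l_i}\rho_i(x,t)\,v_i(x,t)\,\partial_x\varphi_i(x)\,dx$. -/

import Mathlib

open MeasureTheory Set Filter Topology
open scoped ContDiff

noncomputable section

namespace StarGraph

/-- Real test functions of class `C^∞` with compact support in the open interval `(0, a)`. -/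
def IsTest (a : ℝ) (η : ℝ → ℝ) : Prop :=
  ContDiff ℝ ∞ η ∧ HasCompactSupport η ∧ tsupport η ⊆ Ioo 0 a

/-- Lebesgue measure on the open interval `(0, a)`. -/
abbrev mu (a : ℝ) : Measure ℝ := volume.restrict (Ioo 0 a)

/-- The weak (distributional) derivative on `(0, a)` of a function with values in a normed space:
`∫ η' f = - ∫ η g` for all test functions `η`. -/
def HasWeakDeriv {E : Type*} [NormedAddCommGroup E] [NormedSpace ℝ E]
    (a : ℝ) (f g : ℝ → E) : Prop :=
  ∀ η : ℝ → ℝ, IsTest a η → ∫ s, deriv η s • f s ∂(mu a) = - ∫ s, η s • g s ∂(mu a)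

/-- The space `L²(0, a)`. -/
abbrev L2 (a : ℝ) : Type := Lp ℝ 2 (mu a)

theorem IsTest.continuous_deriv {a : ℝ} {η : ℝ → ℝ} (h : IsTest a η) : Continuous (deriv η) :=
  h.1.continuous_deriv (by simp)

/-- A continuous compactly supported weight times an `L²` function is integrable. -/
theorem integrable_smul_of_compact {E : Type*} [NormedAddCommGroup E] [NormedSpace ℝ E]
    {a : ℝ} {w : ℝ → ℝ} (hc : Continuous w) (hs : HasCompactSupport w) (f : Lp E 2 (mu a)) :
    Integrable (fun s => w s • f s) (mu a) := by
  obtain ⟨C, hC⟩ := hc.bounded_above_of_compact_support hs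
  have hf : Integrable f (mu a) := (Lp.memLp f).integrable (by norm_num)
  exact hf.bdd_smul C hc.aestronglyMeasurable (Eventually.of_forall hC)

theorem HasWeakDeriv.congr {E : Type*} [NormedAddCommGroup E] [NormedSpace ℝ E]
    {a : ℝ} {f g f' g' : ℝ → E} (h : HasWeakDeriv a f g)
    (hf : f' =ᵐ[mu a] f) (hg : g' =ᵐ[mu a] g) : HasWeakDeriv a f' g' := by
  intro η hη
  rw [integral_congr_ae (g := fun s => deriv η s • f s), h η hη,
    integral_congr_ae (f := fun s => η s • g' s) (g := fun s => η s • g s)]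
  · filter_upwards [hg] with s hs
    rw [hs]
  · filter_upwards [hf] with s hs
    rw [hs]

theorem hasWeakDeriv_zero {E : Type*} [NormedAddCommGroup E] [NormedSpace ℝ E] {a : ℝ} :
    HasWeakDeriv a (0 : ℝ → E) 0 := by
  intro η _
  simp

theorem HasWeakDeriv.add {E : Type*} [NormedAddCommGroup E] [NormedSpace ℝ E]
    {a : ℝ} {f g f' g' : Lp E 2 (mu a)} (h : HasWeakDeriv a f g) (h' : HasWeakDeriv a f' g') :
    HasWeakDeriv a (⇑f + ⇑f') (⇑g + ⇑g') := by
  intro η hη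
  have hd := integrable_smul_of_compact (E := E) hη.continuous_deriv hη.2.1.deriv (a := a)
  have hi := integrable_smul_of_compact (E := E) hη.1.continuous hη.2.1 (a := a)
  simp only [Pi.add_apply, smul_add]
  rw [integral_add (hd f) (hd f'), integral_add (hi g) (hi g'), h η hη, h' η hη, neg_add]

theorem HasWeakDeriv.smul {E : Type*} [NormedAddCommGroup E] [NormedSpace ℝ E]
    {a : ℝ} {f g : ℝ → E} (c : ℝ) (h : HasWeakDeriv a f g) :
    HasWeakDeriv a (c • f) (c • g) := by
  intro η hη
  simp only [Pi.smul_apply, smul_comm _ c]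
  rw [integral_smul, integral_smul, h η hη, smul_neg]

/-- The pairs `(f, f')` of an `L²` function and its weak derivative in `L²`. -/
def H1Sub (a : ℝ) : Submodule ℝ (WithLp 2 (L2 a × L2 a)) where
  carrier := {p | HasWeakDeriv a p.fst p.snd}
  zero_mem' := hasWeakDeriv_zero.congr (Lp.coeFn_zero _ _ _) (Lp.coeFn_zero _ _ _)
  add_mem' := fun h h' => (h.add h').congr (Lp.coeFn_add _ _) (Lp.coeFn_add _ _)
  smul_mem' := fun c _ h => (h.smul c).congr (Lp.coeFn_smul _ _) (Lp.coeFn_smul _ _)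

/-- The Sobolev space `H¹(0, a)`: its elements are the pairs `(f, f')` of an `L²` function and its
weak derivative in `L²`. It carries the norm `(‖f‖² + ‖f'‖²)^(1/2)`. -/
def H1 (a : ℝ) : Type := H1Sub a

instance (a : ℝ) : NormedAddCommGroup (H1 a) := inferInstanceAs (NormedAddCommGroup (H1Sub a))

instance (a : ℝ) : InnerProductSpace ℝ (H1 a) := inferInstanceAs (InnerProductSpace ℝ (H1Sub a))

/-- The `L²` function underlying an element of `H¹(0, a)`. -/
def H1.val {a : ℝ} (f : H1 a) : L2 a := f.1.fst

/-- The weak derivative of an element of `H¹(0, a)`. -/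
def H1.dx {a : ℝ} (f : H1 a) : L2 a := f.1.snd

/-- The product space `𝕃² = ∏ L²(0, l_i)` with norm `(∑ ‖f_i‖²)^(1/2)`. -/
abbrev LL2 {N : ℕ} (l : Fin N → ℝ) : Type := PiLp 2 (fun i => L2 (l i))

/-- The product space `ℍ¹ = ∏ H¹(0, l_i)` with norm `(∑ ‖f_i‖²)^(1/2)`. -/
abbrev HH1 {N : ℕ} (l : Fin N → ℝ) : Type := PiLp 2 (fun i => H1 (l i))

/-- The product space `𝕃^∞ = ∏ L^∞(Q_i)`, `Q_i = (0, l_i) × (0, T)`, with norm `∑ ‖u_i‖_∞`.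
The first coordinate is the space variable and the second one is time. -/
abbrev LLinf {N : ℕ} (l : Fin N → ℝ) (T : ℝ) : Type :=
  PiLp 1 (fun i => Lp ℝ ⊤ ((volume : Measure (ℝ × ℝ)).restrict (Ioo 0 (l i) ×ˢ Ioo 0 T)))

/-- The subspace of all `φ ∈ ℍ¹` with `φ_i(0) = φ_j(0)` and `φ_i(l_i) = 0`, the point values being
those of the representatives `r_i` of `φ_i` that are continuous on `[0, l_i]`. -/
def VVSub {N : ℕ} (l : Fin N → ℝ) : Submodule ℝ (HH1 l) where
  carrier := {φ | ∃ r : Fin N → ℝ → ℝ,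
    (∀ i, ContinuousOn (r i) (Icc 0 (l i)) ∧ (φ i).val =ᵐ[mu (l i)] r i) ∧
    (∀ i j, r i 0 = r j 0) ∧ ∀ i, r i (l i) = 0}
  zero_mem' := ⟨fun _ _ => 0, fun _ => ⟨continuousOn_const, Lp.coeFn_zero _ _ _⟩,
    fun _ _ => rfl, fun _ => rfl⟩
  add_mem' := by
    rintro φ ψ ⟨r, hr, h0, h1⟩ ⟨q, hq, k0, k1⟩
    refine ⟨fun i => r i + q i, fun i => ⟨(hr i).1.add (hq i).1, ?_⟩, fun i j => ?_, fun i => ?_⟩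
    · exact (Lp.coeFn_add (φ i).val (ψ i).val).trans ((hr i).2.add (hq i).2)
    · simp only [Pi.add_apply, h0 i j, k0 i j]
    · simp only [Pi.add_apply, h1 i, k1 i, add_zero]
  smul_mem' := by
    rintro c φ ⟨r, hr, h0, h1⟩
    refine ⟨fun i => c • r i, fun i => ⟨(hr i).1.const_smul c, ?_⟩, fun i j => ?_, fun i => ?_⟩
    · exact (Lp.coeFn_smul c (φ i).val).trans ((hr i).2.const_smul c)
    · simp only [Pi.smul_apply, h0 i j]
    · simp only [Pi.smul_apply, h1 i, smul_zero]

/-- The space `𝕍` of all `φ ∈ ℍ¹` that are continuous at the central vertex and vanish at the outer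
vertices. It carries the norm of `ℍ¹`. -/
def VV {N : ℕ} (l : Fin N → ℝ) : Type := VVSub l

instance {N : ℕ} (l : Fin N → ℝ) : NormedAddCommGroup (VV l) :=
  inferInstanceAs (NormedAddCommGroup (VVSub l))

instance {N : ℕ} (l : Fin N → ℝ) : InnerProductSpace ℝ (VV l) :=
  inferInstanceAs (InnerProductSpace ℝ (VVSub l))

variable {N : ℕ} {l : Fin N → ℝ} {T : ℝ}

/-- The dual space `𝕍*`. -/
abbrev VVdual (l : Fin N → ℝ) : Type := VV l →L[ℝ] ℝ

/-- The component `φ_i ∈ L²(0, l_i)` of `φ ∈ 𝕍`. -/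
def VV.comp (φ : VV l) (i : Fin N) : L2 (l i) := (φ.1 i).val

/-- The derivative `∂_x φ_i ∈ L²(0, l_i)` of the component `φ_i` of `φ ∈ 𝕍`. -/
def VV.dx (φ : VV l) (i : Fin N) : L2 (l i) := (φ.1 i).dx

theorem VV.norm_comp_le (φ : VV l) (i : Fin N) : ‖φ.comp i‖ ≤ ‖φ.1 i‖ := by
  have h := WithLp.prod_norm_sq_eq_of_L2 (φ.1 i).1
  have h2 : ‖(φ.1 i).1.fst‖ ^ 2 ≤ ‖(φ.1 i).1‖ ^ 2 := by nlinarith [sq_nonneg ‖(φ.1 i).1.snd‖]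
  exact (sq_le_sq₀ (norm_nonneg _) (norm_nonneg _)).1 h2

/-- The embedding `𝕍 ↪ 𝕃²`. -/
def toL2 (l : Fin N → ℝ) : VV l →L[ℝ] LL2 l :=
  LinearMap.mkContinuous
    { toFun := fun φ => WithLp.toLp 2 (fun i => φ.comp i)
      map_add' := fun _ _ => rfl
      map_smul' := fun _ _ => rfl } 1 (by
    intro φ
    rw [one_mul]
    refine (sq_le_sq₀ (norm_nonneg _) (norm_nonneg _)).1 ?_
    change ‖WithLp.toLp 2 (fun i => φ.comp i)‖ ^ 2 ≤ ‖φ.1‖ ^ 2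
    rw [PiLp.norm_sq_eq_of_L2, PiLp.norm_sq_eq_of_L2]
    refine Finset.sum_le_sum fun i _ => ?_
    exact pow_le_pow_left₀ (norm_nonneg _) (φ.norm_comp_le i) 2)

/-- The embedding `𝕍 ↪ 𝕃² ↪ 𝕍*`, `ρ ↦ (φ ↦ (ρ, φ))`, with the scalar product of `𝕃²`. -/
def toDual (l : Fin N → ℝ) : VV l →L[ℝ] VVdual l :=
  (innerSL ℝ (E := LL2 l)).bilinearComp (toL2 l) (toL2 l)

theorem toDual_compLp (f : Lp (VV l) 2 (mu T)) :
    (fun t => toDual l (f t)) =ᵐ[mu T] (toDual l).compLpₗ 2 (mu T) f :=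
  ((toDual l).coeFn_compLp' f).symm

/-- The pairs `(ρ, ρ_t)` of `ρ ∈ L²(0, T; 𝕍)` and its weak time derivative `ρ_t ∈ L²(0, T; 𝕍*)`,
where `ρ` is viewed as a `𝕍*`-valued function. -/
def WWSub (l : Fin N → ℝ) (T : ℝ) :
    Submodule ℝ (WithLp 2 (Lp (VV l) 2 (mu T) × Lp (VVdual l) 2 (mu T))) where
  carrier := {p | HasWeakDeriv T (fun t => toDual l (p.fst t)) p.snd}
  zero_mem' := hasWeakDeriv_zero.congr
    ((toDual_compLp _).trans (by
      rw [WithLp.zero_fst, map_zero]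
      exact Lp.coeFn_zero _ _ _)) (Lp.coeFn_zero _ _ _)
  add_mem' := fun {p q} hp hq =>
    ((hp.congr (toDual_compLp _).symm EventuallyEq.rfl).add
      (hq.congr (toDual_compLp _).symm EventuallyEq.rfl)).congr
      ((toDual_compLp _).trans (by
        rw [WithLp.add_fst, map_add]
        exact Lp.coeFn_add _ _)) (Lp.coeFn_add _ _)
  smul_mem' := fun c p hp =>
    ((hp.congr (toDual_compLp _).symm EventuallyEq.rfl).smul c).congr
      ((toDual_compLp _).trans (by
        rw [WithLp.smul_fst, map_smul]
        exact Lp.coeFn_smul _ _)) (Lp.coeFn_smul _ _)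

/-- The space `𝕎(0, T)`: its elements are the pairs `(ρ, ρ_t)` of `ρ ∈ L²(0, T; 𝕍)` and its weak
time derivative `ρ_t ∈ L²(0, T; 𝕍*)`. It carries the norm `(‖ρ‖² + ‖ρ_t‖²)^(1/2)`. -/
def WW (l : Fin N → ℝ) (T : ℝ) : Type := WWSub l T

instance (l : Fin N → ℝ) (T : ℝ) : NormedAddCommGroup (WW l T) :=
  inferInstanceAs (NormedAddCommGroup (WWSub l T))

instance (l : Fin N → ℝ) (T : ℝ) : NormedSpace ℝ (WW l T) :=
  inferInstanceAs (NormedSpace ℝ (WWSub l T))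

/-- The function `t ↦ ρ(t) ∈ 𝕍` of `ρ ∈ 𝕎(0, T)`. -/
def WW.val (ρ : WW l T) (t : ℝ) : VV l := ρ.1.fst t

/-- The weak time derivative `t ↦ ρ_t(t) ∈ 𝕍*` of `ρ ∈ 𝕎(0, T)`. -/
def WW.dt (ρ : WW l T) (t : ℝ) : VVdual l := ρ.1.snd t

/-- The initial condition `ρ(0) = ρ⁰` in `𝕃²` for `ρ ∈ 𝕎(0, T)`: the value at `0` of the
representative of `ρ` in `C([0, T]; 𝕃²)` is `ρ⁰`. -/
def HasInitialValue (ρ : WW l T) (ρ0 : LL2 l) : Prop :=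
  ∃ r : ℝ → LL2 l, ContinuousOn r (Icc 0 T) ∧
    (∀ᵐ t ∂(mu T), r t = toL2 l (WW.val ρ t)) ∧ r 0 = ρ0

/-- The form `𝓕[u](ρ, φ) = ∑ ∫ (D_i ∂_x ρ_i + u_i ρ_i) ∂_x φ_i dx` at time `t`, for `ρ, φ ∈ 𝕍`. -/
def form (D : Fin N → ℝ) (u : LLinf l T) (t : ℝ) (ρ φ : VV l) : ℝ :=
  ∑ i, ∫ x in Ioo 0 (l i), (D i * ρ.dx i x + u i (x, t) * ρ.comp i x) * φ.dx i x

/-- The functional `d[w](φ) = - ∑ ∫ w_i ∂_x φ_i dx` on `𝕍`. -/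
def dFun (w : Fin N → ℝ → ℝ) (φ : VV l) : ℝ :=
  -∑ i, ∫ x in Ioo 0 (l i), w i x * φ.dx i x

/-- `ρ ∈ 𝕎(0, T)` is a weak solution of the Fokker-Planck problem with drift `u`, source
`f ∈ L²(0, T; 𝕍*)` and initial value `ρ⁰`: for every `φ ∈ 𝕍`,
`d/dt (ρ, φ) + 𝓕[u](ρ, φ) = ⟨f, φ⟩` in the sense of distributions on `(0, T)`, and
`ρ(0) = ρ⁰` in `𝕃²`. -/
def IsWeakSolution (D : Fin N → ℝ) (u : LLinf l T) (f : Lp (VVdual l) 2 (mu T)) (ρ0 : LL2 l)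
    (ρ : WW l T) : Prop :=
  (∀ φ : VV l, ∀ η : ℝ → ℝ, IsTest T η →
    -(∫ t, deriv η t * inner ℝ (toL2 l (WW.val ρ t)) (toL2 l φ) ∂(mu T))
        + ∫ t, η t * form D u t (WW.val ρ t) φ ∂(mu T)
      = ∫ t, η t * f t φ ∂(mu T)) ∧
  HasInitialValue ρ ρ0

/-- `z ∈ 𝕎(0, T)` solves the linearized problem at the control `u` and the state `ρ` in the
direction `v`: `⟨z_t, ·⟩ + 𝓕[u](z, ·) = d[ρ v]` in `L²(0, T; 𝕍*)`, that is in `𝕍*` for almost every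
`t ∈ (0, T)`, and `z(0) = 0` in `𝕃²`. -/
def IsLinearizedSolution (D : Fin N → ℝ) (u v : LLinf l T) (ρ z : WW l T) : Prop :=
  (∀ᵐ t ∂(mu T), ∀ φ : VV l,
    WW.dt z t φ + form D u t (WW.val z t) φ
      = dFun (fun i x => (WW.val ρ t).comp i x * v i (x, t)) φ) ∧
  HasInitialValue z 0

end StarGraph

end

/-! The control enters the state equation affinely. For a control `u` let `L_u w = (w_t + A₀ w + B u
w, w(0))`, where `A₀` comes from the diffusion and `B u` from the drift. This is a bounded operator
from `𝕎(0, T)` to `L²(0, T; 𝕍*) × 𝕃²`, and `u ↦ L_u` is affine and continuous. Once every `L_u` is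
bijective, it is an isomorphism by the open mapping theorem, and `G(u) = L_u⁻¹ (0, ρ⁰)`. Inversion
of operators is smooth, so `G` is differentiable, and differentiating `L_u G(u) = (0, ρ⁰)` gives
`L_u (G'(u) v) = (-B v G(u), 0)`. Since `-B v ρ = d[ρ v]`, this is the linearized problem. The
argument is abstract: `exists_differentiable_solution` and `exists_controlToState`.

The substance is the bijectivity of `L_u` (`bijective_parabolicOp`), obtained without Galerkin
approximation. The Gårding inequality (`garding`) and the energy identity with weight `exp (-2 lam
t)` bound `L_u` from below, so it is injective with closed range (`exists_norm_le_parabolicOp`). A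
pair orthogonal to the range solves the adjoint backward equation with final value zero. The weight
`exp (2 lam t)` forces its first component to vanish, and density of `𝕍` in `𝕃²` then kills the
second one (`orthogonal_range_parabolicOp`).

Both halves rest on the embedding of `𝕎(0, T)` into `C([0, T]; 𝕃²)` and its energy identity
(`IsTimeDeriv.exists_isRep`). There, functions are regularized by bounded operators `V* → V`
(`exists_smoothing`), not by mollification in time: the regularized functions are `V`-valued
primitives, for which the product rule is Fubini's theorem.

It remains to check that the concrete spaces fit this frame and that the distributional and
almost-everywhere formulations are equations in `L²(0, T; 𝕍*)` (`isWeakSolution_iff`,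
`isLinearizedSolution_iff`). -/

noncomputable section

namespace StarGraph

/-! ### Product rule for primitives of integrable functions -/

section Bilinear

variable {E F G : Type*} [NormedAddCommGroup E] [NormedSpace ℝ E] [CompleteSpace E]
  [NormedAddCommGroup F] [NormedSpace ℝ F] [CompleteSpace F]
  [NormedAddCommGroup G] [NormedSpace ℝ G] [CompleteSpace G]


omit [CompleteSpace E] [CompleteSpace F] [CompleteSpace G] in
theorem intervalIntegrable_bilin_left (B : E →L[ℝ] F →L[ℝ] G) {a b : ℝ} (hab : a ≤ b)
    {q : ℝ → E} {P : ℝ → F} (hq : IntervalIntegrable q volume a b)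
    (hP : ContinuousOn P (Icc a b)) :
    IntervalIntegrable (fun s => B (q s) (P s)) volume a b := by
  rw [intervalIntegrable_iff_integrableOn_Ioc_of_le hab] at hq ⊢
  obtain ⟨C, hC⟩ := isCompact_Icc.exists_bound_of_continuousOn hP
  have hPm : AEStronglyMeasurable P (volume.restrict (Ioc a b)) :=
    (hP.mono Ioc_subset_Icc_self).aestronglyMeasurable measurableSet_Ioc
  refine Integrable.mono' ((hq.norm.const_mul ‖B‖).mul_const C)
    (B.aestronglyMeasurable_comp₂ hq.1 hPm) ?_
  filter_upwards [ae_restrict_mem measurableSet_Ioc] with s hs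
  refine (B.le_opNorm₂ _ _).trans ?_
  have := hC s (Ioc_subset_Icc_self hs)
  gcongr

omit [CompleteSpace E] [CompleteSpace F] [CompleteSpace G] in
theorem intervalIntegrable_bilin_right (B : E →L[ℝ] F →L[ℝ] G) {a b : ℝ} (hab : a ≤ b)
    {P : ℝ → E} {q : ℝ → F} (hP : ContinuousOn P (Icc a b))
    (hq : IntervalIntegrable q volume a b) :
    IntervalIntegrable (fun s => B (P s) (q s)) volume a b :=
  intervalIntegrable_bilin_left B.flip hab hq hP

/-- Fubini's theorem on the two triangles of a square. -/
theorem bilin_integral_eq_add (B : E →L[ℝ] F →L[ℝ] G) {a b : ℝ} (hab : a ≤ b)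
    {q₁ : ℝ → E} {q₂ : ℝ → F} (h₁ : IntervalIntegrable q₁ volume a b)
    (h₂ : IntervalIntegrable q₂ volume a b) :
    B (∫ s in a..b, q₁ s) (∫ s in a..b, q₂ s) =
      (∫ s in a..b, B (q₁ s) (∫ t in a..s, q₂ t)) +
        ∫ s in a..b, B (∫ t in a..s, q₁ t) (q₂ s) := by
  have i₁ := (intervalIntegrable_iff_integrableOn_Ioc_of_le hab).1 h₁
  have i₂ := (intervalIntegrable_iff_integrableOn_Ioc_of_le hab).1 h₂
  set μ : Measure ℝ := volume.restrict (Ioc a b) with hμ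
  have hint : Integrable (fun z : ℝ × ℝ => B (q₁ z.1) (q₂ z.2)) (μ.prod μ) :=
    Integrable.op_fst_snd (by fun_prop) ⟨‖B‖, B.le_opNorm₂⟩ i₁ i₂
  have hS : MeasurableSet {z : ℝ × ℝ | z.2 ≤ z.1} := measurableSet_le measurable_snd measurable_fst
  rw [intervalIntegral.integral_of_le hab, intervalIntegral.integral_of_le hab,
    intervalIntegral.integral_of_le hab, intervalIntegral.integral_of_le hab,
    ← integral_prod_bilin B i₁ i₂, ← integral_add_compl hS hint]
  congr 1
  · rw [← integral_indicator hS, integral_prod _ (hint.indicator hS)]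
    refine setIntegral_congr_fun measurableSet_Ioc fun s hs => ?_
    have : (fun t => {z : ℝ × ℝ | z.2 ≤ z.1}.indicator (fun z => B (q₁ z.1) (q₂ z.2)) (s, t)) =
        (Iic s).indicator (fun t => B (q₁ s) (q₂ t)) := by
      ext t; simp [indicator]
    simp only [this]
    rw [integral_indicator measurableSet_Iic, hμ, Measure.restrict_restrict measurableSet_Iic,
      inter_comm, Ioc_inter_Iic, min_eq_right hs.2, intervalIntegral.integral_of_le hs.1.le,
      ContinuousLinearMap.integral_comp_comm]
    exact i₂.mono_set (Ioc_subset_Ioc_right hs.2)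
  -- On the triangle `s < t` the order of integration is exchanged, so that the inner integral is
  -- again a primitive. Its strict inequality produces `Ioo` instead of `Ioc`, a difference of
  -- measure zero.
  · rw [← integral_indicator hS.compl, integral_prod_symm _ (hint.indicator hS.compl)]
    refine setIntegral_congr_fun measurableSet_Ioc fun t ht => ?_
    have : (fun s => {z : ℝ × ℝ | z.2 ≤ z.1}ᶜ.indicator (fun z => B (q₁ z.1) (q₂ z.2)) (s, t)) =
        (Iio t).indicator (fun s => B.flip (q₂ t) (q₁ s)) := by
      ext s; simp [indicator]
    simp only [this]
    rw [integral_indicator measurableSet_Iio, hμ, Measure.restrict_restrict measurableSet_Iio,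
      show Iio t ∩ Ioc a b = Ioo a t by grind, ← integral_Ioc_eq_integral_Ioo,
      intervalIntegral.integral_of_le ht.1.le, ContinuousLinearMap.integral_comp_comm]
    · rfl
    exact i₁.mono_set (Ioc_subset_Ioc_right ht.2)

/-- The product rule for primitives of integrable functions. -/
theorem bilin_primitive_eq (B : E →L[ℝ] F →L[ℝ] G) {a b : ℝ} (hab : a ≤ b)
    {P₁ q₁ : ℝ → E} {P₂ q₂ : ℝ → F} (h₁ : IntervalIntegrable q₁ volume a b)
    (h₂ : IntervalIntegrable q₂ volume a b)
    (e₁ : ∀ t ∈ Icc a b, P₁ t = P₁ a + ∫ s in a..t, q₁ s)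
    (e₂ : ∀ t ∈ Icc a b, P₂ t = P₂ a + ∫ s in a..t, q₂ s) :
    B (P₁ b) (P₂ b) = B (P₁ a) (P₂ a) +
      ((∫ s in a..b, B (q₁ s) (P₂ s)) + ∫ s in a..b, B (P₁ s) (q₂ s)) := by
  have c₁ : ContinuousOn (fun t => ∫ s in a..t, q₁ s) (Icc a b) := by
    simpa [uIcc_of_le hab] using
      intervalIntegral.continuousOn_primitive_interval' h₁ left_mem_uIcc
  have c₂ : ContinuousOn (fun t => ∫ s in a..t, q₂ s) (Icc a b) := by
    simpa [uIcc_of_le hab] using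
      intervalIntegral.continuousOn_primitive_interval' h₂ left_mem_uIcc
  -- Splitting off the initial values leaves only the product of the two pure primitives, which is
  -- the case covered by Fubini.
  have k₁ : (∫ s in a..b, B (q₁ s) (P₂ s)) = B (∫ s in a..b, q₁ s) (P₂ a) +
      ∫ s in a..b, B (q₁ s) (∫ t in a..s, q₂ t) := by
    rw [show B (∫ s in a..b, q₁ s) (P₂ a) = ∫ s in a..b, B.flip (P₂ a) (q₁ s) from
      ((B.flip (P₂ a)).intervalIntegral_comp_comm h₁).symm,
      ← intervalIntegral.integral_add]
    · refine intervalIntegral.integral_congr fun s hs => ?_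
      rw [uIcc_of_le hab] at hs
      simp [e₂ s hs]
    · exact intervalIntegrable_bilin_left B hab h₁ continuousOn_const
    · exact intervalIntegrable_bilin_left B hab h₁ c₂
  have k₂ : (∫ s in a..b, B (P₁ s) (q₂ s)) = B (P₁ a) (∫ s in a..b, q₂ s) +
      ∫ s in a..b, B (∫ t in a..s, q₁ t) (q₂ s) := by
    rw [← (B (P₁ a)).intervalIntegral_comp_comm h₂, ← intervalIntegral.integral_add]
    · refine intervalIntegral.integral_congr fun s hs => ?_
      rw [uIcc_of_le hab] at hs
      simp [e₁ s hs]
    · exact intervalIntegrable_bilin_right B hab continuousOn_const h₂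
    · exact intervalIntegrable_bilin_right B hab c₁ h₂
  rw [k₁, k₂, e₁ b (right_mem_Icc.2 hab), e₂ b (right_mem_Icc.2 hab)]
  simp only [map_add, add_apply]
  rw [bilin_integral_eq_add B hab h₁ h₂]
  abel

end Bilinear

/-! ### Weak derivatives on an interval -/

section WeakDerivative

variable {E : Type*} [NormedAddCommGroup E] [NormedSpace ℝ E]

theorem integral_mu_eq {a : ℝ} (ha : 0 ≤ a) (f : ℝ → E) :
    ∫ s, f s ∂(mu a) = ∫ s in (0 : ℝ)..a, f s := by
  rw [intervalIntegral.integral_of_le ha, integral_Ioc_eq_integral_Ioo]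

omit [NormedSpace ℝ E] in
theorem integrable_mu_iff {a : ℝ} (ha : 0 ≤ a) {f : ℝ → E} :
    Integrable f (mu a) ↔ IntervalIntegrable f volume 0 a := by
  rw [intervalIntegrable_iff_integrableOn_Ioo_of_le ha, IntegrableOn]

theorem IsTest.eq_zero_of_notMem {a : ℝ} {η : ℝ → ℝ} (h : IsTest a η) {x : ℝ} (hx : x ∉ Ioo 0 a) :
    η x = 0 :=
  image_eq_zero_of_notMem_tsupport fun h' => hx (h.2.2 h')

theorem IsTest.integral_deriv {a : ℝ} {η : ℝ → ℝ} (h : IsTest a η) (t : ℝ) :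
    η t = η 0 + ∫ s in (0 : ℝ)..t, deriv η s := by
  rw [intervalIntegral.integral_deriv_eq_sub' η rfl
    (fun x _ => (h.1.differentiable (by simp)).differentiableAt) h.continuous_deriv.continuousOn]
  ring

/-- A primitive of an integrable function has this function as its weak derivative. -/
theorem hasWeakDeriv_primitive [CompleteSpace E] {a : ℝ} (ha : 0 ≤ a) {P q : ℝ → E}
    (hq : IntervalIntegrable q volume 0 a)
    (hP : ∀ t ∈ Icc 0 a, P t = P 0 + ∫ s in (0 : ℝ)..t, q s) : HasWeakDeriv a P q := by
  intro η hη
  have := bilin_primitive_eq (ContinuousLinearMap.lsmul ℝ ℝ (E := E)) ha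
    (hη.continuous_deriv.intervalIntegrable 0 a) hq (fun t _ => hη.integral_deriv t) hP
  -- The boundary terms of the product rule vanish because test functions are zero at both end
  -- points.
  rw [hη.eq_zero_of_notMem (x := 0) (by simp), hη.eq_zero_of_notMem (x := a) (by simp)] at this
  simp only [map_zero, zero_apply, ContinuousLinearMap.lsmul_apply, zero_add] at this
  rw [integral_mu_eq ha, integral_mu_eq ha]
  exact eq_neg_of_add_eq_zero_left this.symm

theorem exists_isTest_integral_eq_one {a : ℝ} (ha : 0 < a) :
    ∃ θ : ℝ → ℝ, IsTest a θ ∧ ∫ s, θ s = 1 := by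
  let f : ContDiffBump (a / 2) := ⟨a / 8, a / 4, by positivity, by linarith⟩
  refine ⟨f.normed volume, ⟨f.contDiff_normed, f.hasCompactSupport_normed, ?_⟩, f.integral_normed⟩
  rw [f.tsupport_normed_eq, Real.closedBall_eq_Icc]
  exact Icc_subset_Ioo (by simp only [f]; linarith) (by simp only [f]; linarith)

theorem IsTest.exists_support_subset {a : ℝ} (ha : 0 < a) {η : ℝ → ℝ} (h : IsTest a η) :
    ∃ c d, 0 < c ∧ d < a ∧ ∀ x, x ∉ Icc c d → η x = 0 := by
  rcases (tsupport η).eq_empty_or_nonempty with h0 | h0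
  · exact ⟨a / 2, a / 2, by linarith, by linarith, fun x _ =>
      image_eq_zero_of_notMem_tsupport (by simp [h0])⟩
  have hc : IsCompact (tsupport η) := h.2.1
  obtain ⟨c, hc1, hc2⟩ := hc.exists_isLeast h0
  obtain ⟨d, hd1, hd2⟩ := hc.exists_isGreatest h0
  exact ⟨c, d, (h.2.2 hc1).1, (h.2.2 hd1).2, fun x hx => image_eq_zero_of_notMem_tsupport
    fun hx' => hx ⟨hc2 hx', hd2 hx'⟩⟩

theorem IsTest.integral_eq {a : ℝ} (ha : 0 ≤ a) {η : ℝ → ℝ} (h : IsTest a η) :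
    ∫ s, η s = ∫ s in (0 : ℝ)..a, η s := by
  rw [← integral_mu_eq ha, setIntegral_eq_integral_of_forall_compl_eq_zero
    fun x hx => h.eq_zero_of_notMem hx]

/-- A test function with vanishing integral is the derivative of a test function. -/
theorem IsTest.exists_eq_deriv {a : ℝ} (ha : 0 < a) {η : ℝ → ℝ} (h : IsTest a η)
    (h0 : ∫ s, η s = 0) : ∃ ζ, IsTest a ζ ∧ deriv ζ = η := by
  have hd : ∀ x, HasDerivAt (fun x => ∫ s in (0 : ℝ)..x, η s) (η x) x := fun x =>
    h.1.continuous.integral_hasStrictDerivAt 0 x |>.hasDerivAt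
  have hd' : deriv (fun x => ∫ s in (0 : ℝ)..x, η s) = η := funext fun x => (hd x).deriv
  obtain ⟨c, d, hc, hda, hcd⟩ := h.exists_support_subset ha
  -- The primitive vanishes to the left of the support since nothing has been integrated yet, and to
  -- the right of it since the total integral is zero.
  have hsupp : ∀ x, x ∉ Icc c d → (∫ s in (0 : ℝ)..x, η s) = 0 := by
    intro x hx
    rcases lt_or_ge x c with hxc | hxc
    · refine (intervalIntegral.integral_congr (g := fun _ => 0) fun s hs => hcd s fun hs' => ?_).trans
        (by simp)
      have := hs.2
      exact absurd hs'.1 (not_le.2 (this.trans_lt (max_lt hc hxc)))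
    · have hxd : d < x := lt_of_not_ge fun h' => hx ⟨hxc, h'⟩
      rw [h.integral_eq ha.le] at h0
      rw [← intervalIntegral.integral_add_adjacent_intervals
        (h.1.continuous.intervalIntegrable 0 a) (h.1.continuous.intervalIntegrable a x), h0,
        zero_add]
      refine (intervalIntegral.integral_congr (g := fun _ => 0) fun s hs => hcd s fun hs' => ?_).trans
        (by simp)
      exact absurd hs'.2 (not_le.2 ((lt_min hda hxd).trans_le hs.1))
  have hts : tsupport (fun x => ∫ s in (0 : ℝ)..x, η s) ⊆ Icc c d :=
    closure_minimal (fun x hx => by_contra fun hx' => hx (hsupp x hx')) isClosed_Icc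
  refine ⟨_, ⟨?_, ?_, hts.trans (Icc_subset_Ioo hc hda)⟩, hd'⟩
  · rw [contDiff_infty_iff_deriv, hd']
    exact ⟨fun x => (hd x).differentiableAt, h.1⟩
  · exact HasCompactSupport.of_support_subset_isCompact isCompact_Icc (subset_closure.trans hts)

theorem IsTest.add_smul {a : ℝ} {η θ : ℝ → ℝ} (h : IsTest a η) (h' : IsTest a θ) (c : ℝ) :
    IsTest a (η + c • θ) := by
  have hs : tsupport (η + c • θ) ⊆ tsupport η ∪ tsupport θ :=
    (tsupport_add _ _).trans (union_subset_union_right _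
      (closure_mono (Function.support_const_smul_subset c θ)))
  exact ⟨h.1.add (h'.1.const_smul c), h.2.1.add h'.2.1.smul_left,
    hs.trans (union_subset h.2.2 h'.2.2)⟩

theorem IsTest.integrable_smul {a : ℝ} {w : ℝ → ℝ} (hc : Continuous w) (hs : HasCompactSupport w)
    {f : ℝ → E} (hf : Integrable f (mu a)) : Integrable (fun s => w s • f s) (mu a) := by
  obtain ⟨C, hC⟩ := hc.bounded_above_of_compact_support hs
  exact hf.bdd_smul C hc.aestronglyMeasurable (Eventually.of_forall hC)

theorem ae_eq_zero_of_integral_isTest_smul [CompleteSpace E] {a : ℝ} {f : ℝ → E}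
    (hf : Integrable f (mu a)) (h : ∀ η, IsTest a η → ∫ s, η s • f s ∂(mu a) = 0) :
    f =ᵐ[mu a] 0 := by
  have hf' : IntegrableOn f (Ioo 0 a) := hf
  have := isOpen_Ioo.ae_eq_zero_of_integral_contDiff_smul_eq_zero
    (hf'.locallyIntegrableOn) (fun g h1 h2 h3 => by
      rw [← h g ⟨h1, h2, h3⟩, setIntegral_eq_integral_of_forall_compl_eq_zero]
      intro x hx
      rw [(show IsTest a g from ⟨h1, h2, h3⟩).eq_zero_of_notMem hx, zero_smul])
  exact (ae_restrict_iff' measurableSet_Ioo).2 this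

/-- The du Bois-Reymond lemma. -/
theorem HasWeakDeriv.ae_eq_const [CompleteSpace E] {a : ℝ} (ha : 0 < a) {f : ℝ → E}
    (hf : Integrable f (mu a)) (h : HasWeakDeriv a f 0) : ∃ c, f =ᵐ[mu a] fun _ => c := by
  obtain ⟨θ, hθ, hθ1⟩ := exists_isTest_integral_eq_one ha
  refine ⟨∫ s, θ s • f s ∂(mu a), ?_⟩
  have hi : Integrable (fun s => f s - ∫ s, θ s • f s ∂(mu a)) (mu a) :=
    hf.sub (integrable_const _)
  have := ae_eq_zero_of_integral_isTest_smul hi fun η hη => by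
    -- Subtracting `(∫ η) θ` gives `η` mean zero, which makes it the derivative of a test function.
    -- The correction accounts for the constant `∫ θ f`.
    obtain ⟨ζ, hζ, hζ'⟩ := (hη.add_smul hθ (-∫ s, η s)).exists_eq_deriv ha (by
      simp only [Pi.add_apply, Pi.smul_apply, smul_eq_mul]
      rw [integral_add (hη.1.continuous.integrable_of_hasCompactSupport hη.2.1)
        ((hθ.1.continuous.integrable_of_hasCompactSupport hθ.2.1).const_mul _),
        integral_const_mul, hθ1]
      ring)
    have h1 := h ζ hζ
    rw [hζ'] at h1
    simp only [Pi.add_apply, Pi.smul_apply, smul_eq_mul, add_smul, Pi.zero_apply, smul_zero,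
      integral_zero, neg_zero, mul_smul] at h1
    rw [integral_add (g := fun s => (-∫ s, η s) • θ s • f s)
      (IsTest.integrable_smul hη.1.continuous hη.2.1 hf)
      ((IsTest.integrable_smul hθ.1.continuous hθ.2.1 hf).smul _), integral_smul] at h1
    simp only [smul_sub]
    rw [integral_sub (IsTest.integrable_smul hη.1.continuous hη.2.1 hf)
      (IsTest.integrable_smul hη.1.continuous hη.2.1 (integrable_const _)),
      integral_smul_const, integral_mu_eq ha.le η, ← hη.integral_eq ha.le]
    rw [neg_smul] at h1
    rw [sub_eq_add_neg]
    exact h1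
  filter_upwards [this] with s hs
  exact sub_eq_zero.1 hs

/-- An integrable function with an integrable weak derivative is a.e. a primitive of it. -/
theorem HasWeakDeriv.exists_ae_eq_primitive [CompleteSpace E] {a : ℝ} (ha : 0 < a) {f g : ℝ → E}
    (hf : Integrable f (mu a)) (hg : Integrable g (mu a)) (h : HasWeakDeriv a f g) :
    ∃ c, f =ᵐ[mu a] fun t => c + ∫ s in (0 : ℝ)..t, g s := by
  have hg' := (integrable_mu_iff ha.le).1 hg
  have hc : ContinuousOn (fun t => ∫ s in (0 : ℝ)..t, g s) (Icc 0 a) := by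
    simpa [uIcc_of_le ha.le] using
      intervalIntegral.continuousOn_primitive_interval' hg' left_mem_uIcc
  have hP : HasWeakDeriv a (fun t => ∫ s in (0 : ℝ)..t, g s) g :=
    hasWeakDeriv_primitive ha.le hg' (fun t _ => by simp)
  have hPi : Integrable (fun t => ∫ s in (0 : ℝ)..t, g s) (mu a) :=
    (hc.integrableOn_Icc).mono_set Ioo_subset_Icc_self
  -- The primitive of `g` has the same weak derivative as `f`, so the du Bois-Reymond lemma applies
  -- to the difference.
  obtain ⟨c, hc⟩ := HasWeakDeriv.ae_eq_const ha (hf.sub hPi) (by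
    intro η hη
    simp only [Pi.sub_apply, smul_sub, Pi.zero_apply, smul_zero, integral_zero, neg_zero]
    rw [integral_sub (IsTest.integrable_smul hη.continuous_deriv hη.2.1.deriv hf)
      (IsTest.integrable_smul hη.continuous_deriv hη.2.1.deriv hPi), h η hη, hP η hη, sub_self])
  refine ⟨c, ?_⟩
  filter_upwards [hc] with t ht
  exact sub_eq_iff_eq_add.1 ht

/-- Functions that are continuous on `[0, a]` and agree a.e. on `(0, a)` agree on `[0, a]`. -/
theorem eqOn_Icc_of_ae_eq {X : Type*} [TopologicalSpace X] [T2Space X] {a : ℝ} (ha : 0 < a)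
    {f g : ℝ → X} (hf : ContinuousOn f (Icc 0 a)) (hg : ContinuousOn g (Icc 0 a))
    (h : f =ᵐ[mu a] g) : EqOn f g (Icc 0 a) := by
  have h1 : EqOn f g (Ioo 0 a) :=
    MeasureTheory.Measure.eqOn_open_of_ae_eq h isOpen_Ioo (hf.mono Ioo_subset_Icc_self)
      (hg.mono Ioo_subset_Icc_self)
  exact h1.of_subset_closure hf hg Ioo_subset_Icc_self (by rw [closure_Ioo ha.ne])

end WeakDerivative

/-! ### Vector-valued square integrable functions -/

section SquareIntegrable

variable {X : Type*} [MeasurableSpace X] {μ : Measure X}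
  {E F G : Type*} [NormedAddCommGroup E] [NormedAddCommGroup F] [NormedAddCommGroup G]

theorem integrable_norm_mul_norm (f : Lp E 2 μ) (g : Lp F 2 μ) :
    Integrable (fun t => ‖f t‖ * ‖g t‖) μ :=
  (Lp.memLp f).norm.integrable_mul (Lp.memLp g).norm

/-- The Cauchy-Schwarz inequality for the norms of vector-valued functions. -/
theorem integral_norm_mul_norm_le (f : Lp E 2 μ) (g : Lp F 2 μ) :
    ∫ t, ‖f t‖ * ‖g t‖ ∂μ ≤ ‖f‖ * ‖g‖ := by
  -- `E` and `F` carry no inner product (dual spaces are needed later), so Cauchy-Schwarz is used in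
  -- scalar `L²` for the functions `‖f‖` and `‖g‖`.
  have h := real_inner_le_norm ((Lp.memLp f).norm.toLp _) ((Lp.memLp g).norm.toLp _)
  rw [L2.inner_def, Lp.norm_toLp, Lp.norm_toLp, eLpNorm_norm, eLpNorm_norm, ← Lp.norm_def,
    ← Lp.norm_def] at h
  refine le_trans (le_of_eq (integral_congr_ae ?_)) h
  filter_upwards [(Lp.memLp f).norm.coeFn_toLp, (Lp.memLp g).norm.coeFn_toLp] with t h1 h2
  rw [h1, h2, real_inner_eq_re_inner, RCLike.inner_apply]
  simp [mul_comm]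

theorem norm_sq_eq_integral (f : Lp E 2 μ) : ‖f‖ ^ 2 = ∫ t, ‖f t‖ ^ 2 ∂μ := by
  have h := real_inner_self_eq_norm_sq ((Lp.memLp f).norm.toLp _)
  rw [L2.inner_def, Lp.norm_toLp, eLpNorm_norm, ← Lp.norm_def] at h
  rw [← h]
  refine integral_congr_ae ?_
  filter_upwards [(Lp.memLp f).norm.coeFn_toLp] with t h1
  rw [h1, real_inner_self_eq_norm_sq, norm_norm]

theorem integrable_norm_sq (f : Lp E 2 μ) : Integrable (fun t => ‖f t‖ ^ 2) μ := by
  simpa [sq] using integrable_norm_mul_norm f f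

theorem integrable_coeFn [IsFiniteMeasure μ] (f : Lp E 2 μ) : Integrable f μ :=
  (Lp.memLp f).integrable (by norm_num)

/-- Cauchy-Schwarz against the constant function one; its norm serves as `C`, uniformly in `f`. -/
theorem exists_integral_norm_le (μ : Measure X) [IsFiniteMeasure μ] (E : Type*)
    [NormedAddCommGroup E] : ∃ C : ℝ, 0 ≤ C ∧ ∀ f : Lp E 2 μ, ∫ t, ‖f t‖ ∂μ ≤ C * ‖f‖ := by
  refine ⟨‖Lp.const 2 μ (1 : ℝ)‖, norm_nonneg _, fun f => ?_⟩
  refine le_trans (le_of_eq (integral_congr_ae ?_)) (integral_norm_mul_norm_le (Lp.const 2 μ (1 : ℝ)) f)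
  filter_upwards [Lp.coeFn_const (p := 2) (μ := μ) (1 : ℝ)] with t ht
  rw [ht]
  simp

variable [NormedSpace ℝ E] [NormedSpace ℝ F] [NormedSpace ℝ G]

theorem integrable_bilin (B : E →L[ℝ] F →L[ℝ] G) (f : Lp E 2 μ) (g : Lp F 2 μ) :
    Integrable (fun t => B (f t) (g t)) μ := by
  refine ((integrable_norm_mul_norm f g).const_mul ‖B‖).mono'
    (B.aestronglyMeasurable_comp₂ (Lp.aestronglyMeasurable f) (Lp.aestronglyMeasurable g))
    (Eventually.of_forall fun t => ?_)
  rw [← mul_assoc]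
  exact B.le_opNorm₂ _ _

theorem continuous_integral_smul {a : ℝ} {w : ℝ → ℝ} (hc : Continuous w)
    (hs : HasCompactSupport w) : Continuous fun f : Lp E 2 (mu a) => ∫ s, w s • f s ∂(mu a) := by
  obtain ⟨K, hK⟩ := hc.bounded_above_of_compact_support hs
  obtain ⟨C, hC0, hC⟩ := exists_integral_norm_le (mu a) E
  let L : Lp E 2 (mu a) →L[ℝ] E := LinearMap.mkContinuous
    { toFun := fun f => ∫ s, w s • f s ∂(mu a)
      map_add' := fun f g => by
        rw [← integral_add (integrable_smul_of_compact hc hs f)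
          (integrable_smul_of_compact hc hs g)]
        refine integral_congr_ae ?_
        filter_upwards [Lp.coeFn_add f g] with s h
        rw [h, Pi.add_apply, smul_add]
      map_smul' := fun c f => by
        rw [← integral_smul]
        refine integral_congr_ae ?_
        filter_upwards [Lp.coeFn_smul c f] with s h
        rw [h, Pi.smul_apply, RingHom.id_apply, smul_comm] } (K * C) (fun f => by
    refine (norm_integral_le_integral_norm _).trans ?_
    calc ∫ s, ‖w s • f s‖ ∂(mu a) ≤ ∫ s, K * ‖f s‖ ∂(mu a) := by
          refine integral_mono (integrable_smul_of_compact hc hs f).norm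
            ((integrable_coeFn f).norm.const_mul K) fun s => ?_
          simp only [norm_smul]
          exact mul_le_mul_of_nonneg_right (hK s) (norm_nonneg _)
      _ = K * ∫ s, ‖f s‖ ∂(mu a) := integral_const_mul _ _
      _ ≤ K * (C * ‖f‖) := mul_le_mul_of_nonneg_left (hC f) ((norm_nonneg _).trans (hK 0))
      _ = K * C * ‖f‖ := (mul_assoc _ _ _).symm)
  exact L.continuous

/-- Pairs of square integrable functions, the second one being the weak derivative of the image of
the first one under a bounded operator, form a closed set. -/
theorem isClosed_hasWeakDeriv {a : ℝ} (J : E →L[ℝ] F) :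
    IsClosed {p : WithLp 2 (Lp E 2 (mu a) × Lp F 2 (mu a)) |
      HasWeakDeriv a (fun t => J (p.fst t)) p.snd} := by
  -- Each test function contributes one equation between continuous functions of the pair, so the
  -- set is an intersection of closed sets.
  have : {p : WithLp 2 (Lp E 2 (mu a) × Lp F 2 (mu a)) |
      HasWeakDeriv a (fun t => J (p.fst t)) p.snd} = ⋂ (η : ℝ → ℝ) (_ : IsTest a η),
      {p | ∫ s, deriv η s • J.compLpL 2 (mu a) p.fst s ∂(mu a) = - ∫ s, η s • p.snd s ∂(mu a)} := by
    ext p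
    simp only [mem_ofPred_eq, mem_iInter]
    refine forall₂_congr fun η hη => ?_
    rw [integral_congr_ae]
    filter_upwards [J.coeFn_compLpL (p := 2) p.fst] with t ht
    rw [ht]
  rw [this]
  refine isClosed_iInter fun η => isClosed_iInter fun hη => isClosed_eq ?_ ?_
  · exact (continuous_integral_smul hη.continuous_deriv hη.2.1.deriv).comp
      ((J.compLpL 2 (mu a)).continuous.comp (WithLp.prod_continuous_ofLp 2 _ _).fst)
  · exact ((continuous_integral_smul hη.1.continuous hη.2.1).comp
      (WithLp.prod_continuous_ofLp 2 _ _).snd).neg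

end SquareIntegrable

/-! ### Gelfand triples and smoothing operators -/

section GelfandTriple

variable {V H : Type*} [NormedAddCommGroup V] [InnerProductSpace ℝ V]
  [NormedAddCommGroup H] [InnerProductSpace ℝ H]

/-- The map `V → H → V*` induced by a bounded operator `V → H`. -/
def gelfand (ι : V →L[ℝ] H) : V →L[ℝ] V →L[ℝ] ℝ := (innerSL ℝ (E := H)).bilinearComp ι ι

@[simp] theorem gelfand_apply (ι : V →L[ℝ] H) (x y : V) : gelfand ι x y = inner ℝ (ι x) (ι y) :=
  rfl

/-- The Riesz isomorphism of a real Hilbert space as a linear map. -/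
def riesz (V : Type*) [NormedAddCommGroup V] [InnerProductSpace ℝ V] [CompleteSpace V] :
    V ≃ₗᵢ[ℝ] (V →L[ℝ] ℝ) where
  toFun x := InnerProductSpace.toDual ℝ V x
  invFun ℓ := (InnerProductSpace.toDual ℝ V).symm ℓ
  map_add' x y := map_add _ x y
  map_smul' c x := by simp
  left_inv x := by simp
  right_inv ℓ := by simp
  norm_map' x := LinearIsometryEquiv.norm_map _ x

@[simp] theorem riesz_apply [CompleteSpace V] (x y : V) : riesz V x y = inner ℝ x y := rfl

@[simp] theorem inner_riesz_symm [CompleteSpace V] (ℓ : V →L[ℝ] ℝ) (y : V) :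
    inner ℝ ((riesz V).symm ℓ) y = ℓ y := InnerProductSpace.toDual_symm_apply

/-- Lax-Milgram: the form `(ι x, ι y)` is nonnegative, and adding `ε` times the scalar product of
`V` makes it coercive with constant `ε`. With `J = gelfand ι` and `R = riesz V`, the operator is `S
= (J + ε R)⁻¹`, a bounded substitute for the inverse of `J`. -/
theorem exists_resolvent [CompleteSpace V] (ι : V →L[ℝ] H) {ε : ℝ} (hε : 0 < ε) :
    ∃ S : (V →L[ℝ] ℝ) →L[ℝ] V, ∀ ℓ ψ,
      inner ℝ (ι (S ℓ)) (ι ψ) + ε * inner ℝ (S ℓ) ψ = ℓ ψ := by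
  have hco : IsCoercive (gelfand ι + ε • gelfand (ContinuousLinearMap.id ℝ V)) := by
    refine ⟨ε, hε, fun u => ?_⟩
    have := mul_self_nonneg ‖ι u‖
    simp only [add_apply, gelfand_apply, smul_apply, ContinuousLinearMap.id_apply,
      real_inner_self_eq_norm_mul_norm, smul_eq_mul]
    nlinarith
  refine ⟨(hco.continuousLinearEquivOfBilin.symm : V →L[ℝ] V).comp
    ((riesz V).symm.toContinuousLinearEquiv : (V →L[ℝ] ℝ) →L[ℝ] V),
    fun ℓ ψ => ?_⟩
  have := hco.continuousLinearEquivOfBilin_apply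
    (hco.continuousLinearEquivOfBilin.symm ((riesz V).symm ℓ)) ψ
  rw [ContinuousLinearEquiv.apply_symm_apply, inner_riesz_symm] at this
  rw [this]
  simp

section Resolvent

variable {ι : V →L[ℝ] H} {ε : ℝ} {S : (V →L[ℝ] ℝ) →L[ℝ] V}

theorem resolvent_unique (hε : 0 < ε)
    (hS : ∀ ℓ ψ, inner ℝ (ι (S ℓ)) (ι ψ) + ε * inner ℝ (S ℓ) ψ = ℓ ψ) {ℓ : V →L[ℝ] ℝ} {y : V}
    (hy : ∀ ψ, inner ℝ (ι y) (ι ψ) + ε * inner ℝ y ψ = ℓ ψ) : S ℓ = y := by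
  have h1 := hS ℓ (S ℓ - y)
  have h2 := hy (S ℓ - y)
  have h3 : inner ℝ (ι (S ℓ - y)) (ι (S ℓ - y)) + ε * inner ℝ (S ℓ - y) (S ℓ - y) = 0 := by
    rw [inner_sub_left (S ℓ) y, map_sub ι (S ℓ) y, inner_sub_left (ι (S ℓ)), ← map_sub]
    linarith
  rw [real_inner_self_eq_norm_sq, real_inner_self_eq_norm_sq] at h3
  have h4 : ‖S ℓ - y‖ ^ 2 = 0 := by
    have := sq_nonneg ‖ι (S ℓ - y)‖
    have := sq_nonneg ‖S ℓ - y‖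
    nlinarith
  exact sub_eq_zero.1 (norm_eq_zero.1 (pow_eq_zero_iff two_ne_zero |>.1 h4))

/-- Testing the equation of `y = S (J x)` with `y - x` gives `‖ι (y - x)‖² + ε (y, y - x) = 0`,
hence `‖y‖² ≤ (y, x)`. The bound does not depend on `ε`. -/
theorem norm_resolvent_gelfand_le (hε : 0 < ε)
    (hS : ∀ ℓ ψ, inner ℝ (ι (S ℓ)) (ι ψ) + ε * inner ℝ (S ℓ) ψ = ℓ ψ) (x : V) :
    ‖S (gelfand ι x)‖ ≤ ‖x‖ := by
  set y := S (gelfand ι x) with hy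
  have h1 := hS (gelfand ι x) (y - x)
  rw [← hy, gelfand_apply] at h1
  have h2 : inner ℝ (ι (y - x)) (ι (y - x)) + ε * inner ℝ y (y - x) = 0 := by
    rw [map_sub ι y x, inner_sub_left, ← map_sub]
    linarith
  rw [real_inner_self_eq_norm_sq, inner_sub_right, real_inner_self_eq_norm_sq] at h2
  have h3 := real_inner_le_norm y x
  have h4 : ‖y‖ ^ 2 ≤ ‖y‖ * ‖x‖ := by
    have := sq_nonneg ‖ι (y - x)‖
    nlinarith
  by_contra! h
  nlinarith [norm_nonneg x, norm_nonneg y]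

/-- With `K = R⁻¹ J` one has `S R = (K + ε)⁻¹`, which commutes with `K`. The relation `J S = R (S J)
R⁻¹` obtained in this way carries bounds and limits of `S J` on `V` over to `J S` on `V*`. -/
theorem gelfand_resolvent_eq [CompleteSpace V] (hε : 0 < ε)
    (hS : ∀ ℓ ψ, inner ℝ (ι (S ℓ)) (ι ψ) + ε * inner ℝ (S ℓ) ψ = ℓ ψ) (z : V) :
    gelfand ι (S (riesz V z)) =
      riesz V (S (gelfand ι z)) := by
  set y := (riesz V).symm (gelfand ι (S (riesz V z)))
    with hy
  have hyψ : ∀ ψ, inner ℝ y ψ = inner ℝ (ι (S (riesz V z))) (ι ψ) := fun ψ => by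
    rw [hy, inner_riesz_symm, gelfand_apply]
  have : S (gelfand ι z) = y := resolvent_unique hε hS fun ψ => by
    set κ := (riesz V).symm (gelfand ι ψ) with hκ
    have hκx : ∀ x, inner ℝ x κ = inner ℝ (ι x) (ι ψ) := fun x => by
      rw [real_inner_comm, hκ, inner_riesz_symm, gelfand_apply, real_inner_comm]
    have h := hS (riesz V z) κ
    rw [riesz_apply, hκx, hκx, ← hyψ κ, hκx, ← hyψ ψ] at h
    rw [h, gelfand_apply]
  rw [this, hy, LinearIsometryEquiv.apply_symm_apply]

/-- For `z = K w` the error `d = S (J z) - z` satisfies `‖ι d‖² + ε ‖d‖² = -ε (ι w, ι d)`, and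
Young's inequality absorbs `‖ι d‖²`. This gives convergence at rate `√ε` on the range of `K`. -/
theorem resolvent_gelfand_sub_sq_le (hε : 0 < ε)
    (hS : ∀ ℓ ψ, inner ℝ (ι (S ℓ)) (ι ψ) + ε * inner ℝ (S ℓ) ψ = ℓ ψ) {z w : V}
    (hz : ∀ x, inner ℝ z x = inner ℝ (ι w) (ι x)) :
    ‖S (gelfand ι z) - z‖ ^ 2 ≤ ε * ‖ι w‖ ^ 2 := by
  set d := S (gelfand ι z) - z with hd
  have hSd : S (gelfand ι z) = d + z := by rw [hd, sub_add_cancel]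
  have h1 := hS (gelfand ι z) d
  rw [hSd, gelfand_apply, map_add, inner_add_left, inner_add_left, hz,
    real_inner_self_eq_norm_sq, real_inner_self_eq_norm_sq] at h1
  have h2 := neg_le_of_abs_le (abs_real_inner_le_norm (ι w) (ι d))
  have h3 : ε * ‖d‖ ^ 2 ≤ ε * (ε * ‖ι w‖ ^ 2) := by
    nlinarith [sq_nonneg (‖ι d‖ - ε * ‖ι w‖ / 2), mul_le_mul_of_nonneg_left h2 hε.le,
      sq_nonneg (ε * ‖ι w‖)]
  exact le_of_mul_le_mul_left h3 hε

end Resolvent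

/-- Smoothing operators `V* → V` approximating the inverse of `V → H → V*`. -/
theorem exists_smoothing [CompleteSpace V] {ι : V →L[ℝ] H} (hι : Function.Injective ι) :
    ∃ S : ℕ → (V →L[ℝ] ℝ) →L[ℝ] V,
      (∀ n x, ‖S n (gelfand ι x)‖ ≤ ‖x‖) ∧ (∀ n ℓ, ‖gelfand ι (S n ℓ)‖ ≤ ‖ℓ‖) ∧
      (∀ x, Tendsto (fun n => S n (gelfand ι x)) atTop (𝓝 x)) ∧
      ∀ ℓ, Tendsto (fun n => gelfand ι (S n ℓ)) atTop (𝓝 ℓ) := by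
  have hε : ∀ n : ℕ, (0 : ℝ) < 1 / (n + 1) := fun n => by positivity
  choose S hS using fun n : ℕ => exists_resolvent ι (hε n)
  have hb : ∀ n x, ‖S n (gelfand ι x)‖ ≤ ‖x‖ := fun n => norm_resolvent_gelfand_le (hε n) (hS n)
  have hg : ∀ n ℓ, gelfand ι (S n ℓ) = riesz V
      (S n (gelfand ι ((riesz V).symm ℓ))) := fun n ℓ => by
    have := gelfand_resolvent_eq (hε n) (hS n) ((riesz V).symm ℓ)
    rwa [LinearIsometryEquiv.apply_symm_apply] at this
  have hlim : ∀ x, Tendsto (fun n => S n (gelfand ι x)) atTop (𝓝 x) := by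
    let K : V →L[ℝ] V :=
      ((riesz V).symm.toContinuousLinearEquiv : (V →L[ℝ] ℝ) →L[ℝ] V).comp
        (gelfand ι)
    have hK : ∀ w x, inner ℝ (K w) x = inner ℝ (ι w) (ι x) := fun w x => by
      simp [K]
    -- An `x` orthogonal to the range of `K` is orthogonal to `K x`, so `‖ι x‖² = (K x, x) = 0`, and
    -- `x = 0` by injectivity of `ι`.
    have hdense : Dense (range K) := by
      have : K.range.topologicalClosure = ⊤ := by
        rw [Submodule.topologicalClosure_eq_top_iff, Submodule.eq_bot_iff]
        intro x hx
        rw [Submodule.mem_orthogonal] at hx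
        have := hx (K x) ⟨x, rfl⟩
        rw [hK, real_inner_self_eq_norm_sq] at this
        have h0 : ι x = 0 := norm_eq_zero.1 (pow_eq_zero_iff two_ne_zero |>.1 this)
        exact hι (h0.trans (map_zero ι).symm)
      rw [← Submodule.dense_iff_topologicalClosure_eq_top] at this
      exact this
    intro x
    rw [Metric.tendsto_atTop]
    intro e he
    -- Convergence is known on the dense range of `K` and extends to `x` by the bound `hb`, uniform
    -- in `n`; three errors of size below `e / 4` occur.
    obtain ⟨_, hz, ⟨w, rfl⟩⟩ := Metric.dense_iff.1 hdense x (e / 4) (by positivity)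
    have hz' : ‖x - K w‖ < e / 4 := by
      rw [← dist_eq_norm, dist_comm]; exact hz
    have h0 : Tendsto (fun n : ℕ => (1 / ((n : ℝ) + 1)) * ‖ι w‖ ^ 2) atTop (𝓝 0) := by
      simpa using tendsto_one_div_add_atTop_nhds_zero_nat.mul_const (‖ι w‖ ^ 2)
    obtain ⟨M, hM⟩ := eventually_atTop.1
      (h0.eventually (gt_mem_nhds (show (0 : ℝ) < (e / 4) ^ 2 by positivity)))
    refine ⟨M, fun n hn => ?_⟩
    have h1 := resolvent_gelfand_sub_sq_le (hε n) (hS n) (hK w)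
    have h2 : ‖S n (gelfand ι (K w)) - K w‖ < e / 4 :=
      lt_of_pow_lt_pow_left₀ 2 (by positivity) (h1.trans_lt (hM n hn))
    have h3 := hb n (x - K w)
    rw [dist_eq_norm]
    calc ‖S n (gelfand ι x) - x‖
        = ‖S n (gelfand ι (x - K w)) + (S n (gelfand ι (K w)) - K w) - (x - K w)‖ := by
          rw [map_sub, map_sub]; congr 1; abel
      _ ≤ ‖S n (gelfand ι (x - K w))‖ + ‖S n (gelfand ι (K w)) - K w‖ + ‖x - K w‖ :=
          (norm_sub_le _ _).trans (add_le_add_left (norm_add_le _ _) _)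
      _ < e := by linarith
  refine ⟨S, hb, fun n ℓ => ?_, hlim, fun ℓ => ?_⟩
  · rw [hg, LinearIsometryEquiv.norm_map]
    exact (hb _ _).trans (by rw [LinearIsometryEquiv.norm_map])
  · simp only [hg]
    have := ((riesz V).continuous.tendsto _).comp
      (hlim ((riesz V).symm ℓ))
    rwa [LinearIsometryEquiv.apply_symm_apply] at this

end GelfandTriple

/-- Pointwise convergence of uniformly bounded operators carries over to `L²`. -/
theorem tendsto_compLpL {X E F : Type*} [MeasurableSpace X] {μ : Measure X}
    [NormedAddCommGroup E] [NormedSpace ℝ E] [NormedAddCommGroup F] [NormedSpace ℝ F]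
    {L : ℕ → E →L[ℝ] F} {L₀ : E →L[ℝ] F} {C : ℝ} (hC : ∀ n x, ‖L n x‖ ≤ C * ‖x‖)
    (hL : ∀ x, Tendsto (fun n => L n x) atTop (𝓝 (L₀ x))) (f : Lp E 2 μ) :
    Tendsto (fun n => (L n).compLpL 2 μ f) atTop (𝓝 (L₀.compLpL 2 μ f)) := by
  rw [tendsto_iff_norm_sub_tendsto_zero]
  have hn : ∀ n, ‖(L n).compLpL 2 μ f - L₀.compLpL 2 μ f‖ ^ 2 = ∫ t, ‖L n (f t) - L₀ (f t)‖ ^ 2 ∂μ := by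
    intro n
    rw [norm_sq_eq_integral]
    refine integral_congr_ae ?_
    filter_upwards [(L n).coeFn_compLpL (p := 2) f, L₀.coeFn_compLpL (p := 2) f,
      Lp.coeFn_sub ((L n).compLpL 2 μ f) (L₀.compLpL 2 μ f)] with t h1 h2 h3
    rw [h3, Pi.sub_apply, h1, h2]
  have h0 : Tendsto (fun n => ‖(L n).compLpL 2 μ f - L₀.compLpL 2 μ f‖ ^ 2) atTop (𝓝 0) := by
    simp only [hn]
    rw [show (0 : ℝ) = ∫ t : X, (0 : ℝ) ∂μ by simp]
    refine tendsto_integral_of_dominated_convergence (fun t => (C + ‖L₀‖) ^ 2 * ‖f t‖ ^ 2)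
      (fun n => ?_) ((integrable_norm_sq f).const_mul _) (fun n => Eventually.of_forall fun t => ?_)
      (Eventually.of_forall fun t => ?_)
    · exact (((L n).continuous.comp_aestronglyMeasurable (Lp.aestronglyMeasurable f)).sub
        (L₀.continuous.comp_aestronglyMeasurable (Lp.aestronglyMeasurable f))).norm.pow 2
    · rw [Real.norm_of_nonneg (sq_nonneg _), ← mul_pow]
      refine pow_le_pow_left₀ (norm_nonneg _) ((norm_sub_le _ _).trans ?_) 2
      rw [add_mul]
      exact add_le_add (hC n _) (L₀.le_opNorm _)
    · have := (((hL (f t)).sub_const (L₀ (f t))).norm.pow 2)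
      simpa using this
  have := h0.sqrt
  simpa [Real.sqrt_sq (norm_nonneg _)] using this

/-- The hypothesis has the shape delivered by `norm_sq_smoothing_sub_le`: the right-hand side is
independent of `t` and quadratic in differences of two Cauchy sequences. -/
theorem uniformCauchySeqOn_of_norm_sq_le {X E F G : Type*} [NormedAddCommGroup E]
    [NormedAddCommGroup F] [NormedAddCommGroup G] {x : ℕ → E} {y : ℕ → F} (hx : CauchySeq x)
    (hy : CauchySeq y) {u : ℕ → X → G} {s : Set X} {C : ℝ} (hC : 0 ≤ C)
    (h : ∀ n m, ∀ t ∈ s, ‖u n t - u m t‖ ^ 2 ≤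
      C * ‖x n - x m‖ ^ 2 + 4 * (‖y n - y m‖ * ‖x n - x m‖)) :
    UniformCauchySeqOn u atTop s := by
  rw [Metric.uniformCauchySeqOn_iff]
  intro ε hε
  have hK1 : 1 ≤ C + 4 := by linarith
  -- With both differences below `δ = ε / (C + 4)` the right-hand side is at most `(C + 4) δ²`, and
  -- this is at most `ε²` because `C + 4 ≥ 1`.
  have hδ : 0 < ε / (C + 4) := by positivity
  obtain ⟨N₁, hN₁⟩ := Metric.cauchySeq_iff.1 hx _ hδ
  obtain ⟨N₂, hN₂⟩ := Metric.cauchySeq_iff.1 hy _ hδ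
  refine ⟨max N₁ N₂, fun m hm n hn t ht => ?_⟩
  have h1 := hN₁ m (le_of_max_le_left hm) n (le_of_max_le_left hn)
  have h2 := hN₂ m (le_of_max_le_right hm) n (le_of_max_le_right hn)
  rw [dist_eq_norm] at h1 h2 ⊢
  refine lt_of_pow_lt_pow_left₀ 2 hε.le ((h m n t ht).trans_lt ?_)
  have e1 : ‖x m - x n‖ ^ 2 < (ε / (C + 4)) ^ 2 :=
    pow_lt_pow_left₀ h1 (norm_nonneg _) two_ne_zero
  have e2 : ‖y m - y n‖ * ‖x m - x n‖ < (ε / (C + 4)) ^ 2 := by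
    rw [sq]
    exact mul_lt_mul'' h2 h1 (norm_nonneg _) (norm_nonneg _)
  have e3 : C * ‖x m - x n‖ ^ 2 ≤ C * (ε / (C + 4)) ^ 2 := mul_le_mul_of_nonneg_left e1.le hC
  have e4 : (C + 4) * (ε / (C + 4)) ^ 2 ≤ ε ^ 2 := by
    rw [div_pow, mul_div_assoc', div_le_iff₀ (by positivity)]
    nlinarith [mul_nonneg (mul_nonneg (zero_le_one.trans hK1) (sub_nonneg.2 hK1)) (sq_nonneg ε)]
  linarith

/-! ### Continuous representatives and the energy identity -/

section Embedding

variable {V H : Type*} [NormedAddCommGroup V] [InnerProductSpace ℝ V]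
  [NormedAddCommGroup H] [InnerProductSpace ℝ H] {T : ℝ}

/-- `r` is a representative of `ι ∘ f` that is continuous on `[0, T]`. -/
def IsRep (ι : V →L[ℝ] H) (f : Lp V 2 (mu T)) (r : ℝ → H) : Prop :=
  ContinuousOn r (Icc 0 T) ∧ ∀ᵐ t ∂(mu T), r t = ι (f t)

/-- The function `g` with values in `V*` is the weak time derivative of `f`. -/
def IsTimeDeriv (ι : V →L[ℝ] H) (f : Lp V 2 (mu T)) (g : Lp (V →L[ℝ] ℝ) 2 (mu T)) : Prop :=
  HasWeakDeriv T (fun t => gelfand ι (f t)) g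

theorem IsRep.add {ι : V →L[ℝ] H} {f f' : Lp V 2 (mu T)} {r r' : ℝ → H} (h : IsRep ι f r)
    (h' : IsRep ι f' r') : IsRep ι (f + f') (r + r') := by
  refine ⟨h.1.add h'.1, ?_⟩
  filter_upwards [h.2, h'.2, Lp.coeFn_add f f'] with t h1 h2 h3
  rw [h3, Pi.add_apply, Pi.add_apply, map_add, h1, h2]

theorem IsRep.smul {ι : V →L[ℝ] H} {f : Lp V 2 (mu T)} {r : ℝ → H} (c : ℝ) (h : IsRep ι f r) :
    IsRep ι (c • f) (c • r) := by
  refine ⟨h.1.const_smul c, ?_⟩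
  filter_upwards [h.2, Lp.coeFn_smul c f] with t h1 h2
  rw [h2, Pi.smul_apply, Pi.smul_apply, map_smul, h1]

theorem IsRep.eqOn {ι : V →L[ℝ] H} {f : Lp V 2 (mu T)} {r r' : ℝ → H} (hT : 0 < T)
    (h : IsRep ι f r) (h' : IsRep ι f r') : EqOn r r' (Icc 0 T) := by
  refine eqOn_Icc_of_ae_eq hT h.1 h'.1 ?_
  filter_upwards [h.2, h'.2] with t h1 h2
  rw [h1, h2]

theorem IsTimeDeriv.add {ι : V →L[ℝ] H} {f f' : Lp V 2 (mu T)}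
    {g g' : Lp (V →L[ℝ] ℝ) 2 (mu T)} (h : IsTimeDeriv ι f g) (h' : IsTimeDeriv ι f' g') :
    IsTimeDeriv ι (f + f') (g + g') := by
  have h1 := HasWeakDeriv.congr h ((gelfand ι).coeFn_compLpL (p := 2) f) EventuallyEq.rfl
  have h2 := HasWeakDeriv.congr h' ((gelfand ι).coeFn_compLpL (p := 2) f') EventuallyEq.rfl
  refine (h1.add h2).congr ?_ (Lp.coeFn_add _ _)
  filter_upwards [(gelfand ι).coeFn_compLpL (p := 2) f, (gelfand ι).coeFn_compLpL (p := 2) f',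
    Lp.coeFn_add f f'] with t h1 h2 h3
  rw [h3, Pi.add_apply, Pi.add_apply, h1, h2, map_add]

/-- A function with derivative `k` is bounded by its mean and the integral of `|k|`. -/
theorem le_mean_add {T : ℝ} (hT : 0 < T) {e k : ℝ → ℝ} (hk : Integrable k (mu T))
    (he : ∀ t ∈ Icc 0 T, e t = e 0 + ∫ s in (0 : ℝ)..t, k s) {t : ℝ} (ht : t ∈ Icc 0 T) :
    e t ≤ T⁻¹ * (∫ s, e s ∂(mu T)) + 2 * ∫ s, |k s| ∂(mu T) := by
  have hk' := (integrable_mu_iff hT.le).1 hk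
  have hb : ∀ s ∈ Icc 0 T, |∫ τ in (0 : ℝ)..s, k τ| ≤ ∫ s, |k s| ∂(mu T) := fun s hs => by
    rw [integral_mu_eq hT.le]
    refine (intervalIntegral.abs_integral_le_integral_abs hs.1).trans ?_
    exact intervalIntegral.integral_mono_interval le_rfl hs.1 hs.2
      (Eventually.of_forall fun _ => abs_nonneg _) hk'.abs
  have hce : ContinuousOn e (Icc 0 T) := by
    refine ContinuousOn.congr (f := fun t => e 0 + ∫ s in (0 : ℝ)..t, k s) ?_ he
    refine continuousOn_const.add ?_
    simpa [uIcc_of_le hT.le] using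
      intervalIntegral.continuousOn_primitive_interval' hk' left_mem_uIcc
  have hei : Integrable e (mu T) := hce.integrableOn_Icc.mono_set Ioo_subset_Icc_self
  -- Both `e t` and `e s` differ from `e 0` by at most `∫ |k|`, so `e t - 2 ∫ |k| ≤ e s`; this is
  -- then averaged over `s`.
  have h1 : ∫ s, (e t - 2 * ∫ s, |k s| ∂(mu T)) ∂(mu T) ≤ ∫ s, e s ∂(mu T) := by
    refine integral_mono_ae (integrable_const _) hei ?_
    filter_upwards [ae_restrict_mem measurableSet_Ioo] with s hs
    have hs' := Ioo_subset_Icc_self hs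
    have h1 := hb s hs'
    have h2 := hb t ht
    rw [he t ht, he s hs']
    rw [abs_le] at h1 h2
    linarith
  rw [integral_const] at h1
  simp only [measureReal_restrict_apply, MeasurableSet.univ, univ_inter, Real.volume_real_Ioo,
    sub_zero, max_eq_left hT.le, smul_eq_mul] at h1
  have h2 := mul_le_mul_of_nonneg_left h1 (inv_nonneg.2 hT.le)
  rw [inv_mul_cancel_left₀ hT.ne'] at h2
  linarith

/-- `R` is a `V*`-valued representative of `J ∘ f` defined at every time. The operators `V* → V` act
on it at individual points, which is not possible for `f` itself. -/
theorem IsTimeDeriv.exists_primitive {ι : V →L[ℝ] H} (hT : 0 < T) {f : Lp V 2 (mu T)}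
    {g : Lp (V →L[ℝ] ℝ) 2 (mu T)} (h : IsTimeDeriv ι f g) :
    ∃ R : ℝ → V →L[ℝ] ℝ, (∀ t, R t = R 0 + ∫ s in (0 : ℝ)..t, g s) ∧
      ∀ᵐ t ∂(mu T), gelfand ι (f t) = R t := by
  have hf : Integrable (fun t => gelfand ι (f t)) (mu T) :=
    (gelfand ι).integrable_comp (integrable_coeFn f)
  obtain ⟨c, hc⟩ := HasWeakDeriv.exists_ae_eq_primitive hT hf (integrable_coeFn g) h
  exact ⟨_, fun t => by simp, hc⟩

variable [CompleteSpace V]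

/-- The energy identity for images under bounded operators `V* → V`. -/
theorem norm_sq_smoothing {ι : V →L[ℝ] H} (hT : 0 < T) {g : Lp (V →L[ℝ] ℝ) 2 (mu T)}
    {R : ℝ → V →L[ℝ] ℝ} (hR : ∀ t, R t = R 0 + ∫ s in (0 : ℝ)..t, g s)
    (S : (V →L[ℝ] ℝ) →L[ℝ] V) {t : ℝ} (ht : t ∈ Icc 0 T) :
    ‖ι (S (R t))‖ ^ 2 = ‖ι (S (R 0))‖ ^ 2 +
      ∫ s in (0 : ℝ)..t, 2 * gelfand ι (S (g s)) (S (R s)) := by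
  have hg : IntervalIntegrable (g : ℝ → V →L[ℝ] ℝ) volume 0 t :=
    ((integrable_mu_iff hT.le).1 (integrable_coeFn g)).mono_set (by
      rw [uIcc_of_le ht.1, uIcc_of_le hT.le]; exact Icc_subset_Icc_right ht.2)
  have hSg : IntervalIntegrable (fun s => S (g s)) volume 0 t :=
    ⟨S.integrable_comp hg.1, S.integrable_comp hg.2⟩
  have hSR : ∀ τ ∈ Icc 0 t, S (R τ) = S (R 0) + ∫ s in (0 : ℝ)..τ, S (g s) := fun τ hτ => by
    rw [hR τ, map_add, S.intervalIntegral_comp_comm]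
    exact hg.mono_set (by rw [uIcc_of_le ht.1, uIcc_of_le hτ.1]; exact Icc_subset_Icc_right hτ.2)
  have := bilin_primitive_eq (gelfand ι) ht.1 hSg hSg hSR hSR
  rw [gelfand_apply, gelfand_apply, real_inner_self_eq_norm_sq, real_inner_self_eq_norm_sq] at this
  rw [this, intervalIntegral.integral_const_mul, two_mul]
  congr 2
  refine intervalIntegral.integral_congr fun s _ => ?_
  simp [real_inner_comm]

/-- The energy identity for `S - S'` has integrand `2 G(F)`, where `F` and `G` are the differences
of the regularizations of `f` and of `g`. Through `le_mean_add` the supremum in time is controlled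
by their `L²` norms alone; the factor `4` is the `2` of that lemma times the `2` of the energy
identity. -/
theorem norm_sq_smoothing_sub_le {ι : V →L[ℝ] H} (hT : 0 < T) {f : Lp V 2 (mu T)}
    {g : Lp (V →L[ℝ] ℝ) 2 (mu T)} {R : ℝ → V →L[ℝ] ℝ}
    (hR : ∀ t, R t = R 0 + ∫ s in (0 : ℝ)..t, g s)
    (hfR : ∀ᵐ t ∂(mu T), gelfand ι (f t) = R t) (S S' : (V →L[ℝ] ℝ) →L[ℝ] V) {t : ℝ}
    (ht : t ∈ Icc 0 T) :
    ‖ι (S (R t)) - ι (S' (R t))‖ ^ 2 ≤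
      T⁻¹ * (‖ι‖ ^ 2 * ‖(S.comp (gelfand ι)).compLpL 2 (mu T) f -
        (S'.comp (gelfand ι)).compLpL 2 (mu T) f‖ ^ 2) +
      4 * (‖((gelfand ι).comp S).compLpL 2 (mu T) g - ((gelfand ι).comp S').compLpL 2 (mu T) g‖ *
        ‖(S.comp (gelfand ι)).compLpL 2 (mu T) f - (S'.comp (gelfand ι)).compLpL 2 (mu T) f‖) := by
  set F := (S.comp (gelfand ι)).compLpL 2 (mu T) f - (S'.comp (gelfand ι)).compLpL 2 (mu T) f with hFd
  set G := ((gelfand ι).comp S).compLpL 2 (mu T) g - ((gelfand ι).comp S').compLpL 2 (mu T) g with hGd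
  have hFae : ∀ᵐ s ∂(mu T), (S - S') (R s) = F s := by
    filter_upwards [hfR, (S.comp (gelfand ι)).coeFn_compLpL (p := 2) f, (S'.comp (gelfand ι)).coeFn_compLpL (p := 2) f,
      Lp.coeFn_sub ((S.comp (gelfand ι)).compLpL 2 (mu T) f) ((S'.comp (gelfand ι)).compLpL 2 (mu T) f)] with s h0 h1 h2 h3
    rw [hFd, h3, Pi.sub_apply, h1, h2, ← h0]
    rfl
  have hGae : ∀ᵐ s ∂(mu T), gelfand ι ((S - S') (g s)) = G s := by
    filter_upwards [((gelfand ι).comp S).coeFn_compLpL (p := 2) g, ((gelfand ι).comp S').coeFn_compLpL (p := 2) g,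
      Lp.coeFn_sub (((gelfand ι).comp S).compLpL 2 (mu T) g) (((gelfand ι).comp S').compLpL 2 (mu T) g)] with s h1 h2 h3
    rw [hGd, h3, Pi.sub_apply, h1, h2, sub_apply, map_sub]
    rfl
  have hk : (fun s => 2 * gelfand ι ((S - S') (g s)) ((S - S') (R s))) =ᵐ[mu T]
      fun s => 2 * G s (F s) := by
    filter_upwards [hFae, hGae] with s h1 h2
    rw [h1, h2]
  have hGF : Integrable (fun s => 2 * G s (F s)) (mu T) :=
    (integrable_bilin (ContinuousLinearMap.id ℝ (V →L[ℝ] ℝ)) G F).const_mul 2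
  have h1 := le_mean_add hT (e := fun t => ‖ι ((S - S') (R t))‖ ^ 2) (hGF.congr hk.symm)
    (fun t ht => norm_sq_smoothing hT hR (S - S') ht) ht
  rw [← map_sub]
  refine h1.trans (add_le_add (mul_le_mul_of_nonneg_left ?_ (inv_nonneg.2 hT.le)) ?_)
  · rw [norm_sq_eq_integral, ← integral_const_mul]
    have hi := (integrable_norm_sq F).const_mul (‖ι‖ ^ 2)
    refine integral_mono_of_nonneg (Eventually.of_forall fun s => sq_nonneg _) hi ?_
    filter_upwards [hFae] with s hs
    rw [hs, ← mul_pow]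
    exact pow_le_pow_left₀ (norm_nonneg _) (ι.le_opNorm _) 2
  · rw [show (4 : ℝ) = 2 * 2 by norm_num, mul_assoc]
    refine mul_le_mul_of_nonneg_left ?_ zero_le_two
    refine le_trans ?_ (mul_le_mul_of_nonneg_left (integral_norm_mul_norm_le G F) zero_le_two)
    rw [← integral_const_mul]
    refine integral_mono_of_nonneg (Eventually.of_forall fun s => abs_nonneg _)
      ((integrable_norm_mul_norm G F).const_mul 2) ?_
    filter_upwards [hk] with s hs
    rw [hs, abs_mul, abs_two]
    exact mul_le_mul_of_nonneg_left ((G s).le_opNorm _) zero_le_two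

/-- `W(0, T)` embeds into `C([0, T]; H)`, and the energy identity holds. -/
theorem IsTimeDeriv.exists_isRep [CompleteSpace H] {ι : V →L[ℝ] H} (hι : Function.Injective ι) (hT : 0 < T)
    {f : Lp V 2 (mu T)} {g : Lp (V →L[ℝ] ℝ) 2 (mu T)} (h : IsTimeDeriv ι f g) :
    ∃ r, IsRep ι f r ∧ ∀ t ∈ Icc 0 T, ‖r t‖ ^ 2 = ‖r 0‖ ^ 2 + ∫ s in (0 : ℝ)..t, 2 * g s (f s) := by
  obtain ⟨R, hR, hfR⟩ := h.exists_primitive hT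
  obtain ⟨S, hS1, hS2, hS3, hS4⟩ := exists_smoothing hι
  let A : ℕ → V →L[ℝ] V := fun n => (S n).comp (gelfand ι)
  let B : ℕ → (V →L[ℝ] ℝ) →L[ℝ] (V →L[ℝ] ℝ) := fun n => (gelfand ι).comp (S n)
  have hF : CauchySeq fun n => (A n).compLpL 2 (mu T) f :=
    (tendsto_compLpL (C := 1) (L := A) (L₀ := ContinuousLinearMap.id ℝ V) (fun n x => by
      rw [one_mul]; exact hS1 n x) hS3 f).cauchySeq
  have hG : CauchySeq fun n => (B n).compLpL 2 (mu T) g :=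
    (tendsto_compLpL (C := 1) (L := B) (L₀ := ContinuousLinearMap.id ℝ (V →L[ℝ] ℝ)) (fun n x => by
      rw [one_mul]; exact hS2 n x) hS4 g).cauchySeq
  have hRc : ContinuousOn R (Icc 0 T) := by
    refine ContinuousOn.congr (f := fun t => R 0 + ∫ s in (0 : ℝ)..t, g s) ?_ fun t _ => hR t
    refine continuousOn_const.add ?_
    simpa [uIcc_of_le hT.le] using intervalIntegral.continuousOn_primitive_interval'
      ((integrable_mu_iff hT.le).1 (integrable_coeFn g)) left_mem_uIcc
  -- The regularizations of `f` and `g` converge in `L²`, so the continuous functions `ι (S n (R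
  -- t))` are uniformly Cauchy and their limit `r` is continuous.
  have hunif : UniformCauchySeqOn (fun n t => ι (S n (R t))) atTop (Icc 0 T) :=
    uniformCauchySeqOn_of_norm_sq_le hF hG (C := T⁻¹ * ‖ι‖ ^ 2) (by positivity)
      fun n m t ht => by
        rw [mul_assoc]
        exact norm_sq_smoothing_sub_le hT hR hfR (S n) (S m) ht
  have hlim : ∀ t ∈ Icc 0 T, ∃ y, Tendsto (fun n => ι (S n (R t))) atTop (𝓝 y) := fun t ht =>
    cauchySeq_tendsto_of_complete (hunif.cauchySeq ht)
  choose! r hr using hlim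
  have hru := hunif.tendstoUniformlyOn_of_tendsto hr
  have hrc : ContinuousOn r (Icc 0 T) := hru.continuousOn (Frequently.of_forall fun n =>
    (ι.continuous.comp (S n).continuous).comp_continuousOn hRc)
  refine ⟨r, ⟨hrc, ?_⟩, fun t ht => ?_⟩
  · filter_upwards [hfR, ae_restrict_mem measurableSet_Ioo] with t h1 h2
    refine tendsto_nhds_unique (hr t (Ioo_subset_Icc_self h2)) ?_
    rw [← h1]
    exact (ι.continuous.tendsto _).comp (hS3 (f t))
  · have h1 : Tendsto (fun n => ‖ι (S n (R t))‖ ^ 2) atTop (𝓝 (‖r t‖ ^ 2)) := (hr t ht).norm.pow 2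
    have h2 : Tendsto (fun n => ‖ι (S n (R 0))‖ ^ 2) atTop (𝓝 (‖r 0‖ ^ 2)) :=
      (hr 0 (left_mem_Icc.2 hT.le)).norm.pow 2
    have hsub : Ioc 0 t ⊆ Ioc 0 T := Ioc_subset_Ioc_right ht.2
    have hae : ∀ {P : ℝ → Prop}, (∀ᵐ s ∂(mu T), P s) → ∀ᵐ s, s ∈ uIoc 0 t → P s := fun {P} hP => by
      rw [uIoc_of_le ht.1]
      have : ∀ᵐ s ∂(volume.restrict (Ioc 0 T)), P s := by
        rwa [← restrict_Ioo_eq_restrict_Ioc]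
      filter_upwards [(ae_restrict_iff' measurableSet_Ioc).1 this] with s hs hs'
      exact hs (hsub hs')
    -- Almost everywhere `R s = J (f s)`, so the integrand is `2 (J S n) g` applied to `(S n J) f`.
    -- It converges pointwise to `2 g(f)` and is dominated by `2 ‖g‖ ‖f‖`, since both operators are
    -- contractions.
    have h3 : Tendsto (fun n => ∫ s in (0 : ℝ)..t, 2 * gelfand ι (S n (g s)) (S n (R s))) atTop
        (𝓝 (∫ s in (0 : ℝ)..t, 2 * g s (f s))) := by
      have hgi := ((integrable_mu_iff hT.le).1 (integrable_coeFn g)).mono_set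
        (c := 0) (d := t) (by
          rw [uIcc_of_le ht.1, uIcc_of_le hT.le]; exact Icc_subset_Icc_right ht.2)
      refine intervalIntegral.tendsto_integral_filter_of_dominated_convergence
        (fun s => 2 * (‖g s‖ * ‖f s‖)) (Eventually.of_forall fun n => ?_)
        (Eventually.of_forall fun n => ?_) ?_ ?_
      · rw [uIoc_of_le ht.1]
        refine AEStronglyMeasurable.const_mul ?_ 2
        refine (gelfand ι).aestronglyMeasurable_comp₂ ?_ ?_
        · exact ((S n).integrable_comp hgi.1).1
        · exact ((S n).continuous.comp_continuousOn
            (hRc.mono (Ioc_subset_Icc_self.trans (Icc_subset_Icc_right ht.2)))).aestronglyMeasurable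
            measurableSet_Ioc
      · refine hae ?_
        filter_upwards [hfR] with s hs
        rw [norm_mul, Real.norm_ofNat, ← hs]
        refine mul_le_mul_of_nonneg_left ?_ zero_le_two
        refine ((gelfand ι (S n (g s))).le_opNorm _).trans ?_
        exact mul_le_mul (hS2 n _) (hS1 n _) (norm_nonneg _) (norm_nonneg _)
      · exact (((integrable_mu_iff hT.le).1 ((integrable_norm_mul_norm g f).const_mul 2)).mono_set
          (by rw [uIcc_of_le ht.1, uIcc_of_le hT.le]; exact Icc_subset_Icc_right ht.2))
      · refine hae ?_
        filter_upwards [hfR] with s hs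
        rw [← hs]
        exact ((isBoundedBilinearMap_apply.continuous.tendsto (g s, f s)).comp
          ((hS4 (g s)).prodMk_nhds (hS3 (f s)))).const_mul 2
    refine tendsto_nhds_unique h1 ?_
    simp only [norm_sq_smoothing hT hR _ ht]
    exact h2.add h3

end Embedding

/-- A weakly measurable function with values in a separable Hilbert space is measurable. -/
theorem stronglyMeasurable_of_inner {X V : Type*} [MeasurableSpace X] [NormedAddCommGroup V]
    [InnerProductSpace ℝ V] [SecondCountableTopology V] {f : X → V}
    (h : ∀ y, Measurable fun t => (inner ℝ (f t) y : ℝ)) : StronglyMeasurable f := by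
  borelize V
  refine Measurable.stronglyMeasurable (measurable_of_isOpen fun U hU => ?_)
  let d := TopologicalSpace.denseSeq V
  have hd : DenseRange d := TopologicalSpace.denseRange_denseSeq V
  -- Membership in a closed ball amounts to `(f t - c, y) ≤ q ‖y‖` for all `y`, and by continuity a
  -- dense sequence of `y` is enough.
  have hball : ∀ (c : V) (q : ℝ), 0 < q → MeasurableSet {t | ‖f t - c‖ ≤ q} := fun c q hq => by
    have : {t | ‖f t - c‖ ≤ q} = ⋂ k, {t | inner ℝ (f t) (d k) - inner ℝ c (d k) ≤ q * ‖d k‖} := by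
      ext t
      simp only [mem_ofPred_eq, mem_iInter, ← inner_sub_left]
      refine ⟨fun ht k => (real_inner_le_norm _ _).trans (by gcongr), fun ht => ?_⟩
      have hall : ∀ y, inner ℝ (f t - c) y ≤ q * ‖y‖ := fun y =>
        hd.induction_on (p := fun y => inner ℝ (f t - c) y ≤ q * ‖y‖) y
          (isClosed_le (by fun_prop) (by fun_prop)) ht
      have := hall (f t - c)
      rw [real_inner_self_eq_norm_sq] at this
      by_contra! h'
      nlinarith
    rw [this]
    exact MeasurableSet.iInter fun k => measurableSet_le ((h _).sub_const _) measurable_const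
  have hU' : f ⁻¹' U = ⋃ (k : ℕ) (q : ℚ) (_ : 0 < (q : ℝ) ∧ Metric.closedBall (d k) q ⊆ U),
      {t | ‖f t - d k‖ ≤ q} := by
    ext t
    simp only [mem_preimage, mem_iUnion, mem_ofPred_eq]
    constructor
    · intro ht
      obtain ⟨ε, hε, hεU⟩ := Metric.isOpen_iff.1 hU _ ht
      obtain ⟨q, hq0, hq⟩ := exists_rat_btwn (show (0 : ℝ) < ε / 2 by positivity)
      obtain ⟨k, hk⟩ := hd.exists_dist_lt (f t) hq0
      refine ⟨k, q, ⟨hq0, fun y hy => hεU ?_⟩, by rw [← dist_eq_norm]; exact hk.le⟩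
      rw [Metric.mem_closedBall] at hy
      rw [Metric.mem_ball]
      calc dist y (f t) ≤ dist y (d k) + dist (d k) (f t) := dist_triangle _ _ _
        _ < ε := by rw [dist_comm (d k)]; linarith
    · rintro ⟨k, q, ⟨_, hq⟩, ht⟩
      exact hq (by rwa [Metric.mem_closedBall, dist_eq_norm])
  rw [hU']
  exact MeasurableSet.iUnion fun k => MeasurableSet.iUnion fun q => MeasurableSet.iUnion fun hq =>
    hball _ _ hq.1

/-! ### Energy estimates for parabolic equations -/

section Parabolic

variable {V H : Type*} [NormedAddCommGroup V] [InnerProductSpace ℝ V] [CompleteSpace V]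
  [NormedAddCommGroup H] [InnerProductSpace ℝ H] {T : ℝ}

/-- Weakly measurable bounded families of bilinear forms act on square integrable functions. -/
theorem exists_superposition [SecondCountableTopology V] (T : ℝ) {a : ℝ → V →L[ℝ] V →L[ℝ] ℝ}
    (ha : ∀ x y, Measurable fun t => a t x y) {C : ℝ} (hC : ∀ t, ‖a t‖ ≤ C) :
    ∃ A : Lp V 2 (mu T) →L[ℝ] Lp (V →L[ℝ] ℝ) 2 (mu T),
      (∀ f, ∀ᵐ t ∂(mu T), A f t = a t (f t)) ∧ ∀ f, ‖A f‖ ≤ C * ‖f‖ := by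
  -- The Riesz isomorphism turns weak measurability of `t ↦ a t x` into that of a function with
  -- values in the separable space `V`, which is therefore strongly measurable.
  have hx : ∀ x, StronglyMeasurable fun t => a t x := fun x => by
    have : StronglyMeasurable fun t => (riesz V).symm (a t x) :=
      stronglyMeasurable_of_inner fun y => by simpa using ha x y
    simpa using (riesz V).continuous.comp_stronglyMeasurable this
  borelize V
  -- A Carathéodory function, measurable in `t` and continuous in `x`, is jointly measurable and may
  -- be composed with `t ↦ (f t, t)`.
  have hu : StronglyMeasurable (Function.uncurry fun (x : V) (t : ℝ) => a t x) :=
    stronglyMeasurable_uncurry_of_continuous_of_stronglyMeasurable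
      (fun t => (a t).continuous) hx
  have hm : ∀ f : Lp V 2 (mu T), StronglyMeasurable fun t => a t (f t) := fun f =>
    hu.comp_measurable ((Lp.stronglyMeasurable f).measurable.prodMk measurable_id)
  have hb : ∀ (f : Lp V 2 (mu T)) t, ‖a t (f t)‖ ≤ C * ‖f t‖ := fun f t =>
    ((a t).le_opNorm _).trans (mul_le_mul_of_nonneg_right (hC t) (norm_nonneg _))
  have hL : ∀ f : Lp V 2 (mu T), MemLp (fun t => a t (f t)) 2 (mu T) := fun f =>
    (Lp.memLp f).of_le_mul (hm f).aestronglyMeasurable (Eventually.of_forall (hb f))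
  have hn : ∀ f, ‖(hL f).toLp _‖ ≤ C * ‖f‖ := fun f =>
    Lp.norm_le_mul_norm_of_ae_le_mul (by
      filter_upwards [(hL f).coeFn_toLp] with t ht
      rw [ht]
      exact hb f t)
  refine ⟨LinearMap.mkContinuous
    { toFun := fun f => (hL f).toLp _
      map_add' := fun f g => by
        refine Lp.ext ?_
        filter_upwards [(hL (f + g)).coeFn_toLp, (hL f).coeFn_toLp, (hL g).coeFn_toLp,
          Lp.coeFn_add f g, Lp.coeFn_add ((hL f).toLp _) ((hL g).toLp _)] with t h1 h2 h3 h4 h5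
        rw [h1, h5, Pi.add_apply, h2, h3, h4, Pi.add_apply, map_add]
      map_smul' := fun c f => by
        refine Lp.ext ?_
        filter_upwards [(hL (c • f)).coeFn_toLp, (hL f).coeFn_toLp,
          Lp.coeFn_smul c f, Lp.coeFn_smul c ((hL f).toLp _)] with t h1 h2 h4 h5
        rw [h1, RingHom.id_apply, h5, Pi.smul_apply, h2, h4, Pi.smul_apply, map_smul] } C hn,
    fun f => (hL f).coeFn_toLp, hn⟩

omit [CompleteSpace V] in
/-- The energy identity with an exponential weight. -/
theorem weighted_energy {ι : V →L[ℝ] H} (hT : 0 < T) {f : Lp V 2 (mu T)}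
    {g : Lp (V →L[ℝ] ℝ) 2 (mu T)} {r : ℝ → H} (hr : IsRep ι f r)
    (he : ∀ t ∈ Icc 0 T, ‖r t‖ ^ 2 = ‖r 0‖ ^ 2 + ∫ s in (0 : ℝ)..t, 2 * g s (f s)) (κ : ℝ) :
    Real.exp (κ * T) * ‖r T‖ ^ 2 = ‖r 0‖ ^ 2 +
      ∫ t, Real.exp (κ * t) * (2 * g t (f t) + κ * ‖ι (f t)‖ ^ 2) ∂(mu T) := by
  have hgf : IntervalIntegrable (fun s => 2 * g s (f s)) volume 0 T :=
    (integrable_mu_iff hT.le).1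
      ((integrable_bilin (ContinuousLinearMap.id ℝ (V →L[ℝ] ℝ)) g f).const_mul 2)
  have hd : ∀ t, HasDerivAt (fun t => Real.exp (κ * t)) (κ * Real.exp (κ * t)) t := fun t => by
    have := ((hasDerivAt_id t).const_mul κ).exp
    simpa [mul_comm] using this
  have hc : Continuous fun t => κ * Real.exp (κ * t) := by fun_prop
  have h := bilin_primitive_eq (ContinuousLinearMap.mul ℝ ℝ) hT.le
    (P₁ := fun t => Real.exp (κ * t)) (q₁ := fun t => κ * Real.exp (κ * t))
    (hc.intervalIntegrable _ _) hgf (fun t _ => by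
      rw [intervalIntegral.integral_eq_sub_of_hasDerivAt (fun s _ => hd s)
        (hc.intervalIntegrable _ _)]
      ring) he
  have hrn : ContinuousOn (fun t => ‖r t‖ ^ 2) (Icc 0 T) := hr.1.norm.pow 2
  simp only [ContinuousLinearMap.mul_apply', mul_zero, Real.exp_zero, one_mul] at h
  rw [h, ← intervalIntegral.integral_add, ← integral_mu_eq hT.le]
  · congr 1
    refine integral_congr_ae ?_
    filter_upwards [hr.2] with t ht
    rw [ht]
    ring
  · refine ContinuousOn.intervalIntegrable ?_
    rw [uIcc_of_le hT.le]
    exact hc.continuousOn.mul hrn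
  · refine hgf.continuousOn_mul ?_
    fun_prop

variable {ι : V →L[ℝ] H} {a : ℝ → V →L[ℝ] V →L[ℝ] ℝ} {α lam : ℝ}

omit [CompleteSpace V] in
/-- The a priori estimate for parabolic equations. -/
theorem parabolic_estimate (hT : 0 < T) (hα : 0 < α) (hlam : 0 ≤ lam)
    (hco : ∀ t x, α * ‖x‖ ^ 2 ≤ a t x x + lam * ‖ι x‖ ^ 2) {f : Lp V 2 (mu T)}
    {g h : Lp (V →L[ℝ] ℝ) 2 (mu T)} {r : ℝ → H} (hr : IsRep ι f r)
    (he : ∀ t ∈ Icc 0 T, ‖r t‖ ^ 2 = ‖r 0‖ ^ 2 + ∫ s in (0 : ℝ)..t, 2 * g s (f s))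
    (hg : ∀ᵐ t ∂(mu T), g t + a t (f t) = h t) :
    α * Real.exp (-(2 * lam) * T) * ‖f‖ ^ 2 ≤ ‖r 0‖ ^ 2 + α⁻¹ * ‖h‖ ^ 2 := by
  -- The exponent `-2 lam` cancels the term `2 lam ‖ι f‖²` lost in the Gårding inequality. The
  -- weight then lies between `exp (-2 lam T)` and `1` on `(0, T)`.
  have hw := weighted_energy hT hr he (-(2 * lam))
  have hle : ∫ t, Real.exp (-(2 * lam) * t) * (2 * g t (f t) + -(2 * lam) * ‖ι (f t)‖ ^ 2) ∂(mu T)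
      ≤ ∫ t, (α⁻¹ * ‖h t‖ ^ 2 - α * Real.exp (-(2 * lam) * T) * ‖f t‖ ^ 2) ∂(mu T) := by
    refine integral_mono_ae ?_ (((integrable_norm_sq h).const_mul _).sub
      ((integrable_norm_sq f).const_mul _)) ?_
    · have hi : Integrable (fun t => 2 * g t (f t) + -(2 * lam) * ‖ι (f t)‖ ^ 2) (mu T) := by
        refine ((integrable_bilin (ContinuousLinearMap.id ℝ (V →L[ℝ] ℝ)) g f).const_mul 2).add
          (Integrable.const_mul ?_ _)
        refine (integrable_norm_sq (ι.compLpL 2 (mu T) f)).congr ?_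
        filter_upwards [ι.coeFn_compLpL (p := 2) f] with t ht
        rw [ht]
      have hc : Continuous fun t => Real.exp (-(2 * lam) * t) := by fun_prop
      exact (integrable_mu_iff hT.le).2
        (((integrable_mu_iff hT.le).1 hi).continuousOn_mul hc.continuousOn)
    · filter_upwards [hg, ae_restrict_mem measurableSet_Ioo] with t ht ht'
      have h1 : g t (f t) = h t (f t) - a t (f t) (f t) := by rw [← ht]; simp
      have h2 := (le_abs_self _).trans ((h t).le_opNorm (f t))
      have h3 := hco t (f t)
      have h4 : 2 * (‖h t‖ * ‖f t‖) ≤ α⁻¹ * ‖h t‖ ^ 2 + α * ‖f t‖ ^ 2 := by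
        have := sq_nonneg (α⁻¹ * ‖h t‖ - ‖f t‖)
        have h5 : α * (α⁻¹ * ‖h t‖ - ‖f t‖) ^ 2 =
            α⁻¹ * ‖h t‖ ^ 2 - 2 * (‖h t‖ * ‖f t‖) + α * ‖f t‖ ^ 2 := by
          field_simp
          ring
        nlinarith [mul_nonneg hα.le this]
      have h6 : 2 * g t (f t) + -(2 * lam) * ‖ι (f t)‖ ^ 2 ≤
          α⁻¹ * ‖h t‖ ^ 2 - α * ‖f t‖ ^ 2 := by
        rw [h1]; linarith
      have h7 : Real.exp (-(2 * lam) * t) ≤ 1 :=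
        Real.exp_le_one_iff.2 (by nlinarith [mul_nonneg hlam ht'.1.le])
      have h8 : Real.exp (-(2 * lam) * T) ≤ Real.exp (-(2 * lam) * t) :=
        Real.exp_le_exp.2 (by nlinarith [mul_le_mul_of_nonneg_left ht'.2.le hlam])
      calc _ ≤ Real.exp (-(2 * lam) * t) * (α⁻¹ * ‖h t‖ ^ 2 - α * ‖f t‖ ^ 2) :=
            mul_le_mul_of_nonneg_left h6 (Real.exp_pos _).le
        _ = Real.exp (-(2 * lam) * t) * (α⁻¹ * ‖h t‖ ^ 2) -
            α * Real.exp (-(2 * lam) * t) * ‖f t‖ ^ 2 := by ring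
        _ ≤ _ := by
          refine sub_le_sub ?_ ?_
          · exact mul_le_of_le_one_left (by positivity) h7
          · gcongr
  rw [integral_sub ((integrable_norm_sq h).const_mul _) ((integrable_norm_sq f).const_mul _),
    integral_const_mul, integral_const_mul, ← norm_sq_eq_integral, ← norm_sq_eq_integral] at hle
  have : 0 ≤ Real.exp (-(2 * lam) * T) * ‖r T‖ ^ 2 := by positivity
  linarith

omit [CompleteSpace V] in
/-- Backward uniqueness for the adjoint equation with vanishing final value. -/
theorem backward_unique (hT : 0 < T) (hα : 0 < α) (hlam : 0 ≤ lam)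
    (hco : ∀ t x, α * ‖x‖ ^ 2 ≤ a t x x + lam * ‖ι x‖ ^ 2) {f : Lp V 2 (mu T)}
    {g : Lp (V →L[ℝ] ℝ) 2 (mu T)} {r : ℝ → H} (hr : IsRep ι f r)
    (he : ∀ t ∈ Icc 0 T, ‖r t‖ ^ 2 = ‖r 0‖ ^ 2 + ∫ s in (0 : ℝ)..t, 2 * g s (f s))
    (hg : ∀ᵐ t ∂(mu T), g t = (a t).flip (f t)) (hrT : r T = 0) : f = 0 := by
  -- For the adjoint equation the lost term has the opposite sign, so the exponent is `2 lam`. The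
  -- weight is at least `1`, and with `r T = 0` all remaining terms are nonnegative and sum to zero.
  have hw := weighted_energy hT hr he (2 * lam)
  have hle : ∫ t, 2 * α * ‖f t‖ ^ 2 ∂(mu T) ≤
      ∫ t, Real.exp (2 * lam * t) * (2 * g t (f t) + 2 * lam * ‖ι (f t)‖ ^ 2) ∂(mu T) := by
    refine integral_mono_ae ((integrable_norm_sq f).const_mul _) ?_ ?_
    · have hi : Integrable (fun t => 2 * g t (f t) + 2 * lam * ‖ι (f t)‖ ^ 2) (mu T) := by
        refine ((integrable_bilin (ContinuousLinearMap.id ℝ (V →L[ℝ] ℝ)) g f).const_mul 2).add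
          (Integrable.const_mul ?_ _)
        refine (integrable_norm_sq (ι.compLpL 2 (mu T) f)).congr ?_
        filter_upwards [ι.coeFn_compLpL (p := 2) f] with t ht
        rw [ht]
      have hc : Continuous fun t => Real.exp (2 * lam * t) := by fun_prop
      exact (integrable_mu_iff hT.le).2
        (((integrable_mu_iff hT.le).1 hi).continuousOn_mul hc.continuousOn)
    · filter_upwards [hg, ae_restrict_mem measurableSet_Ioo] with t ht ht'
      rw [ht, ContinuousLinearMap.flip_apply]
      have h3 := hco t (f t)
      have h7 : 1 ≤ Real.exp (2 * lam * t) :=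
        Real.one_le_exp (by nlinarith [mul_nonneg hlam ht'.1.le])
      have h4 : 2 * α * ‖f t‖ ^ 2 ≤ 2 * a t (f t) (f t) + 2 * lam * ‖ι (f t)‖ ^ 2 := by linarith
      exact h4.trans (le_mul_of_one_le_left (le_trans (by positivity) h4) h7)
  rw [integral_const_mul, ← norm_sq_eq_integral] at hle
  rw [hrT, norm_zero] at hw
  have h0 : ‖f‖ ^ 2 ≤ 0 := by
    have := sq_nonneg ‖r 0‖
    by_contra! h
    have := mul_pos hα h
    nlinarith
  exact norm_eq_zero.1 (pow_eq_zero_iff two_ne_zero |>.1 (le_antisymm h0 (sq_nonneg _)))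

/-- Integration by parts in `W(0, T)`. -/
theorem integral_by_parts [CompleteSpace H] (hι : Function.Injective ι) (hT : 0 < T)
    {f f' : Lp V 2 (mu T)} {g g' : Lp (V →L[ℝ] ℝ) 2 (mu T)} {r r' : ℝ → H}
    (h : IsTimeDeriv ι f g) (h' : IsTimeDeriv ι f' g') (hr : IsRep ι f r) (hr' : IsRep ι f' r') :
    inner ℝ (r T) (r' T) = inner ℝ (r 0) (r' 0) + ∫ t, (g t (f' t) + g' t (f t)) ∂(mu T) := by
  -- The energy identity at time `T` is polarized: it is applied to `f`, to `f'` and to `f + f'`.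
  have key : ∀ {f : Lp V 2 (mu T)} {g : Lp (V →L[ℝ] ℝ) 2 (mu T)} {r : ℝ → H},
      IsTimeDeriv ι f g → IsRep ι f r →
      ‖r T‖ ^ 2 = ‖r 0‖ ^ 2 + 2 * ∫ t, g t (f t) ∂(mu T) := by
    intro f g r h hr
    obtain ⟨q, hq, hq'⟩ := h.exists_isRep hι hT
    rw [hr.eqOn hT hq (right_mem_Icc.2 hT.le), hr.eqOn hT hq (left_mem_Icc.2 hT.le),
      hq' T (right_mem_Icc.2 hT.le), ← integral_mu_eq hT.le, integral_const_mul]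
  have h1 := key h hr
  have h2 := key h' hr'
  have h3 := key (h.add h') (hr.add hr')
  have hi : ∀ (g : Lp (V →L[ℝ] ℝ) 2 (mu T)) (f : Lp V 2 (mu T)),
      Integrable (fun t => g t (f t)) (mu T) := fun g f =>
    integrable_bilin (ContinuousLinearMap.id ℝ (V →L[ℝ] ℝ)) g f
  have h4 : ∫ t, (g + g') t ((f + f') t) ∂(mu T) =
      (∫ t, g t (f t) ∂(mu T)) + (∫ t, g' t (f' t) ∂(mu T)) +
        ∫ t, (g t (f' t) + g' t (f t)) ∂(mu T) := by
    rw [← integral_add (hi _ _) (hi _ _), ← integral_add (f := fun t => g t (f t) + g' t (f' t))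
      (g := fun t => g t (f' t) + g' t (f t)) ((hi _ _).add (hi _ _)) ((hi _ _).add (hi _ _))]
    refine integral_congr_ae ?_
    filter_upwards [Lp.coeFn_add f f', Lp.coeFn_add g g'] with t e1 e2
    rw [e1, e2]
    simp only [Pi.add_apply, map_add, add_apply]
    ring
  rw [h4, Pi.add_apply, Pi.add_apply, norm_add_sq_real, norm_add_sq_real] at h3
  linarith

omit [CompleteSpace V] in
/-- Products of a scalar function of time and a fixed element of `V` belong to `W(0, T)`. -/
theorem exists_smul_const (ι : V →L[ℝ] H) (hT : 0 < T) {θ θ' : ℝ → ℝ} (hθ' : Continuous θ')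
    (hd : ∀ t, HasDerivAt θ (θ' t) t) (ψ : V) :
    ∃ (f : Lp V 2 (mu T)) (g : Lp (V →L[ℝ] ℝ) 2 (mu T)),
      (∀ᵐ t ∂(mu T), f t = θ t • ψ) ∧ (∀ᵐ t ∂(mu T), g t = θ' t • gelfand ι ψ) ∧
      IsTimeDeriv ι f g ∧ IsRep ι f fun t => θ t • ι ψ := by
  have hθ : Continuous θ := continuous_iff_continuousAt.2 fun t => (hd t).continuousAt
  have hm : ∀ {E : Type _} [NormedAddCommGroup E] {u : ℝ → E}, Continuous u →
      MemLp u 2 (mu T) := fun {E} _ {u} hu => by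
    obtain ⟨C, hC⟩ := isCompact_Icc.exists_bound_of_continuousOn (s := Icc 0 T) hu.continuousOn
    refine MemLp.of_bound hu.aestronglyMeasurable C ?_
    filter_upwards [ae_restrict_mem measurableSet_Ioo] with t ht
    exact hC t (Ioo_subset_Icc_self ht)
  have h1 : MemLp (fun t => θ t • ψ) 2 (mu T) := hm (by fun_prop)
  have h2 : MemLp (fun t => θ' t • gelfand ι ψ) 2 (mu T) := hm (by fun_prop)
  refine ⟨h1.toLp _, h2.toLp _, h1.coeFn_toLp, h2.coeFn_toLp, ?_, ?_, ?_⟩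
  · refine HasWeakDeriv.congr (f := fun t => θ t • gelfand ι ψ) ?_ ?_ h2.coeFn_toLp
    · refine hasWeakDeriv_primitive hT.le
        ((hθ'.smul continuous_const).intervalIntegrable _ _) fun t _ => ?_
      rw [intervalIntegral.integral_eq_sub_of_hasDerivAt
        (fun s _ => (hd s).smul_const (gelfand ι ψ))
        ((hθ'.smul continuous_const).intervalIntegrable _ _)]
      abel
    · filter_upwards [h1.coeFn_toLp] with t ht
      rw [ht, map_smul]
  · exact (hθ.smul continuous_const).continuousOn
  · filter_upwards [h1.coeFn_toLp] with t ht
    rw [ht, map_smul]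

end Parabolic

/-! ### Well-posedness by closed and dense range -/

section Solvability

variable {V H W : Type*} [NormedAddCommGroup V] [InnerProductSpace ℝ V] [CompleteSpace V]
  [NormedAddCommGroup H] [InnerProductSpace ℝ H]
  [NormedAddCommGroup W] [NormedSpace ℝ W] {T : ℝ} {ι : V →L[ℝ] H}

/-- The initial value is a bounded operator on `W(0, T)`. -/
theorem exists_initialValue [CompleteSpace H] (hι : Function.Injective ι) (hT : 0 < T)
    (val : W →L[ℝ] Lp V 2 (mu T)) (dt : W →L[ℝ] Lp (V →L[ℝ] ℝ) 2 (mu T))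
    (hW : ∀ w, IsTimeDeriv ι (val w) (dt w)) :
    ∃ τ : W →L[ℝ] H, ∀ w r, IsRep ι (val w) r → r 0 = τ w := by
  choose r hr he using fun w => (hW w).exists_isRep hι hT
  have h0 : (0 : ℝ) ∈ Icc 0 T := left_mem_Icc.2 hT.le
  -- The supremum bound for the energy identity, taken at time `0`, makes the trace bounded. Its
  -- linearity follows from uniqueness of continuous representatives.
  have hb : ∀ w, ‖r w 0‖ ^ 2 ≤
      T⁻¹ * (‖ι‖ ^ 2 * ‖val w‖ ^ 2) + 2 * (2 * (‖dt w‖ * ‖val w‖)) := fun w => by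
    have hi : Integrable (fun s => 2 * dt w s (val w s)) (mu T) :=
      (integrable_bilin (ContinuousLinearMap.id ℝ (V →L[ℝ] ℝ)) (dt w) (val w)).const_mul 2
    refine (le_mean_add hT (e := fun t => ‖r w t‖ ^ 2) hi (he w) h0).trans (add_le_add
      (mul_le_mul_of_nonneg_left ?_ (inv_nonneg.2 hT.le))
      (mul_le_mul_of_nonneg_left ?_ zero_le_two))
    · rw [norm_sq_eq_integral, ← integral_const_mul]
      refine integral_mono_of_nonneg (Eventually.of_forall fun s => sq_nonneg _)
        ((integrable_norm_sq (val w)).const_mul (‖ι‖ ^ 2)) ?_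
      filter_upwards [(hr w).2] with s hs
      rw [hs, ← mul_pow]
      exact pow_le_pow_left₀ (norm_nonneg _) (ι.le_opNorm _) 2
    · refine le_trans ?_ (mul_le_mul_of_nonneg_left
        (integral_norm_mul_norm_le (dt w) (val w)) zero_le_two)
      rw [← integral_const_mul]
      refine integral_mono_of_nonneg (Eventually.of_forall fun s => abs_nonneg _)
        ((integrable_norm_mul_norm (dt w) (val w)).const_mul 2)
        (Eventually.of_forall fun s => ?_)
      simp only [abs_mul, abs_two]
      exact mul_le_mul_of_nonneg_left ((dt w s).le_opNorm _) zero_le_two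
  set K : ℝ := T⁻¹ * (‖ι‖ ^ 2 * ‖val‖ ^ 2) + 2 * (2 * (‖dt‖ * ‖val‖)) with hK
  have hK0 : 0 ≤ K := by positivity
  refine ⟨LinearMap.mkContinuous
    { toFun := fun w => r w 0
      map_add' := fun w w' => by
        have h := (hr w).add (hr w')
        rw [← map_add] at h
        exact (hr (w + w')).eqOn hT h h0
      map_smul' := fun c w => by
        have h := (hr w).smul c
        rw [← map_smul] at h
        exact (hr (c • w)).eqOn hT h h0 } (Real.sqrt K) (fun w => ?_), fun w q hq => ?_⟩
  · rw [← Real.sqrt_sq (norm_nonneg w), ← Real.sqrt_mul hK0]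
    refine Real.le_sqrt_of_sq_le ((hb w).trans ?_)
    have h1 := val.le_opNorm w
    have h2 := dt.le_opNorm w
    calc _ ≤ T⁻¹ * (‖ι‖ ^ 2 * (‖val‖ * ‖w‖) ^ 2) + 2 * (2 * ((‖dt‖ * ‖w‖) * (‖val‖ * ‖w‖))) := by
          gcongr
      _ = K * ‖w‖ ^ 2 := by rw [hK]; ring
  · exact hq.eqOn hT (hr w) h0

/-- The operator `w ↦ (w_t + A w, w(0))` of a parabolic initial value problem, the dual space of `V`
being identified with `V`. -/
def parabolicOp (val : W →L[ℝ] Lp V 2 (mu T)) (dt : W →L[ℝ] Lp (V →L[ℝ] ℝ) 2 (mu T))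
    (τ : W →L[ℝ] H) (A : Lp V 2 (mu T) →L[ℝ] Lp (V →L[ℝ] ℝ) 2 (mu T)) :
    W →L[ℝ] WithLp 2 (Lp V 2 (mu T) × H) :=
  ((WithLp.prodContinuousLinearEquiv 2 ℝ (Lp V 2 (mu T)) H).symm :
    (Lp V 2 (mu T) × H) →L[ℝ] WithLp 2 (Lp V 2 (mu T) × H)).comp
    (((((riesz V).symm.toContinuousLinearEquiv : (V →L[ℝ] ℝ) →L[ℝ] V).compLpL 2 (mu T)).comp
      (dt + A.comp val)).prod τ)

theorem parabolicOp_apply (val : W →L[ℝ] Lp V 2 (mu T)) (dt : W →L[ℝ] Lp (V →L[ℝ] ℝ) 2 (mu T))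
    (τ : W →L[ℝ] H) (A : Lp V 2 (mu T) →L[ℝ] Lp (V →L[ℝ] ℝ) 2 (mu T)) (w : W) :
    parabolicOp val dt τ A w = WithLp.toLp 2
      (((riesz V).symm.toContinuousLinearEquiv : (V →L[ℝ] ℝ) →L[ℝ] V).compLpL 2 (mu T)
        (dt w + A (val w)), τ w) := rfl

theorem norm_riesz_symm_compLpL (g : Lp (V →L[ℝ] ℝ) 2 (mu T)) :
    ‖((riesz V).symm.toContinuousLinearEquiv : (V →L[ℝ] ℝ) →L[ℝ] V).compLpL 2 (mu T) g‖ = ‖g‖ := by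
  refine (Lp.norm_le_norm_of_ae_le ?_).antisymm (Lp.norm_le_norm_of_ae_le ?_)
  all_goals
    filter_upwards [((riesz V).symm.toContinuousLinearEquiv :
      (V →L[ℝ] ℝ) →L[ℝ] V).coeFn_compLpL (p := 2) g] with t ht
    rw [ht]
  · exact ((riesz V).symm.norm_map _).le
  · exact ((riesz V).symm.norm_map _).ge

theorem inner_riesz_symm_compLpL (g : Lp (V →L[ℝ] ℝ) 2 (mu T)) (f : Lp V 2 (mu T)) :
    inner ℝ (((riesz V).symm.toContinuousLinearEquiv :
      (V →L[ℝ] ℝ) →L[ℝ] V).compLpL 2 (mu T) g) f = ∫ t, g t (f t) ∂(mu T) := by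
  rw [L2.inner_def]
  refine integral_congr_ae ?_
  filter_upwards [((riesz V).symm.toContinuousLinearEquiv :
    (V →L[ℝ] ℝ) →L[ℝ] V).coeFn_compLpL (p := 2) g] with t ht
  rw [ht]
  exact inner_riesz_symm _ _

variable {val : W →L[ℝ] Lp V 2 (mu T)} {dt : W →L[ℝ] Lp (V →L[ℝ] ℝ) 2 (mu T)}
  {τ : W →L[ℝ] H} {A A' : Lp V 2 (mu T) →L[ℝ] Lp (V →L[ℝ] ℝ) 2 (mu T)}
  {a : ℝ → V →L[ℝ] V →L[ℝ] ℝ} {α lam : ℝ}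

/-- The parabolic operator is bounded from below. -/
theorem exists_norm_le_parabolicOp [CompleteSpace H] (hι : Function.Injective ι) (hT : 0 < T)
    (hα : 0 < α) (hlam : 0 ≤ lam) (hco : ∀ t x, α * ‖x‖ ^ 2 ≤ a t x x + lam * ‖ι x‖ ^ 2)
    (hA : ∀ f, ∀ᵐ t ∂(mu T), A f t = a t (f t))
    (hW : ∀ w, IsTimeDeriv ι (val w) (dt w))
    (hnorm : ∀ w, ‖w‖ ^ 2 = ‖val w‖ ^ 2 + ‖dt w‖ ^ 2)
    (hτ : ∀ w r, IsRep ι (val w) r → r 0 = τ w) :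
    ∃ K, ∀ w, ‖w‖ ≤ K * ‖parabolicOp val dt τ A w‖ := by
  -- `c` is the factor in front of `‖f‖²` in `parabolic_estimate`, whose right-hand side is at most
  -- `(1 + α⁻¹) ‖y‖²`; hence `‖val w‖² ≤ M ‖y‖²`.
  set c : ℝ := α * Real.exp (-(2 * lam) * T) with hc
  have hc0 : 0 < c := by positivity
  set M : ℝ := (1 + α⁻¹) / c with hM
  have hM0 : 0 < M := by positivity
  refine ⟨Real.sqrt (M + (1 + ‖A‖ * Real.sqrt M) ^ 2), fun w => ?_⟩
  set y := parabolicOp val dt τ A w with hy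
  obtain ⟨r, hr, he⟩ := (hW w).exists_isRep hι hT
  have hyn : ‖y‖ ^ 2 = ‖dt w + A (val w)‖ ^ 2 + ‖τ w‖ ^ 2 := by
    rw [hy, parabolicOp_apply, WithLp.prod_norm_sq_eq_of_L2]
    simp only [WithLp.toLp_fst, WithLp.toLp_snd, norm_riesz_symm_compLpL]
  have h1 := parabolic_estimate hT hα hlam hco (h := dt w + A (val w)) hr he (by
    filter_upwards [hA (val w), Lp.coeFn_add (dt w) (A (val w))] with t h1 h2
    rw [h2, Pi.add_apply, h1])
  rw [hτ w r hr, ← hc] at h1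
  have hα' : 0 < α⁻¹ := inv_pos.2 hα
  have h2 : c * ‖val w‖ ^ 2 ≤ (1 + α⁻¹) * ‖y‖ ^ 2 := by
    nlinarith [sq_nonneg ‖τ w‖, sq_nonneg ‖dt w + A (val w)‖, mul_nonneg hα'.le (sq_nonneg ‖τ w‖)]
  have h3 : ‖val w‖ ^ 2 ≤ M * ‖y‖ ^ 2 := by
    rw [hM, div_mul_eq_mul_div, le_div_iff₀ hc0]
    linarith
  have h4 : ‖val w‖ ≤ Real.sqrt M * ‖y‖ := by
    rw [← Real.sqrt_sq (norm_nonneg y), ← Real.sqrt_mul hM0.le]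
    exact Real.le_sqrt_of_sq_le h3
  have h5 : ‖dt w + A (val w)‖ ≤ ‖y‖ :=
    (sq_le_sq₀ (norm_nonneg _) (norm_nonneg _)).1 (by rw [hyn]; nlinarith [sq_nonneg ‖τ w‖])
  -- The time derivative is recovered from the equation as `(w_t + A w) - A w`.
  have h6 : ‖dt w‖ ≤ (1 + ‖A‖ * Real.sqrt M) * ‖y‖ := by
    calc ‖dt w‖ = ‖(dt w + A (val w)) - A (val w)‖ := by rw [add_sub_cancel_right]
      _ ≤ ‖dt w + A (val w)‖ + ‖A (val w)‖ := norm_sub_le _ _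
      _ ≤ ‖y‖ + ‖A‖ * (Real.sqrt M * ‖y‖) :=
        add_le_add h5 ((A.le_opNorm _).trans (mul_le_mul_of_nonneg_left h4 (norm_nonneg _)))
      _ = _ := by ring
  rw [← Real.sqrt_sq (norm_nonneg y), ← Real.sqrt_mul (by positivity)]
  refine Real.le_sqrt_of_sq_le ?_
  rw [hnorm, add_mul]
  refine add_le_add h3 ?_
  rw [← mul_pow]
  exact pow_le_pow_left₀ (norm_nonneg _) h6 2

/-- The range of the parabolic operator has trivial orthogonal complement. -/
theorem orthogonal_range_parabolicOp [CompleteSpace H] (hι : Function.Injective ι)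
    (hdense : ∀ h, (∀ ψ, inner ℝ (ι ψ) h = 0) → h = 0) (hT : 0 < T)
    (hα : 0 < α) (hlam : 0 ≤ lam) (hco : ∀ t x, α * ‖x‖ ^ 2 ≤ a t x x + lam * ‖ι x‖ ^ 2)
    (hA : ∀ f, ∀ᵐ t ∂(mu T), A f t = a t (f t))
    (hA' : ∀ f, ∀ᵐ t ∂(mu T), A' f t = (a t).flip (f t))
    (hW' : ∀ f g, IsTimeDeriv ι f g → ∃ w, val w = f ∧ dt w = g)
    (hτ : ∀ w r, IsRep ι (val w) r → r 0 = τ w) :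
    (parabolicOp val dt τ A).rangeᗮ = ⊥ := by
  rw [Submodule.eq_bot_iff]
  intro y hy
  rw [Submodule.mem_orthogonal] at hy
  have horth : ∀ w, (∫ t, (dt w t (y.fst t) + a t (val w t) (y.fst t)) ∂(mu T)) +
      inner ℝ (τ w) y.snd = 0 := fun w => by
    have h := hy _ ⟨w, rfl⟩
    change inner ℝ (parabolicOp val dt τ A w) y = 0 at h
    rw [parabolicOp_apply, WithLp.prod_inner_apply] at h
    simp only [inner_riesz_symm_compLpL] at h
    rw [← h]
    congr 1
    refine integral_congr_ae ?_
    filter_upwards [hA (val w), Lp.coeFn_add (dt w) (A (val w))] with t h1 h2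
    rw [h2, Pi.add_apply, h1, add_apply]
    rfl
  -- Orthogonality is used only for `w = θ ψ` with a scalar function `θ` of time. Three choices
  -- suffice: test functions, `θ = t` and `θ = 1`.
  have horth' : ∀ {θ θ' : ℝ → ℝ}, Continuous θ' → (∀ t, HasDerivAt θ (θ' t) t) → ∀ ψ,
      (∫ t, (θ' t * inner ℝ (ι ψ) (ι (y.fst t)) + θ t * a t ψ (y.fst t)) ∂(mu T)) +
        inner ℝ (θ 0 • ι ψ) y.snd = 0 := fun {θ θ'} hθ' hd ψ => by
    obtain ⟨f, g, hf, hg, hfg, hrep⟩ := exists_smul_const ι hT hθ' hd ψ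
    obtain ⟨w, rfl, rfl⟩ := hW' f g hfg
    refine Eq.trans ?_ (horth w)
    rw [← hτ w _ hrep]
    congr 1
    refine integral_congr_ae ?_
    filter_upwards [hf, hg] with t h1 h2
    rw [h1, h2]
    simp
  -- Test functions `θ` vanish at `0`, so the initial value drops out and the relation says that
  -- `y.fst` has weak time derivative `A' y.fst`: the adjoint equation.
  have hφ : IsTimeDeriv ι y.fst (A' y.fst) := fun η hη => by
    have hi : Integrable (fun t => deriv η t • gelfand ι (y.fst t)) (mu T) :=
      IsTest.integrable_smul hη.continuous_deriv hη.2.1.deriv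
        ((gelfand ι).integrable_comp (integrable_coeFn y.fst))
    have hi' : Integrable (fun t => η t • A' y.fst t) (mu T) :=
      integrable_smul_of_compact hη.1.continuous hη.2.1 _
    ext ψ
    rw [neg_apply, ContinuousLinearMap.integral_apply hi, ContinuousLinearMap.integral_apply hi']
    have h := horth' hη.continuous_deriv
      (fun t => ((hη.1.differentiable (by simp)) t).hasDerivAt) ψ
    rw [hη.eq_zero_of_notMem (x := 0) (by simp), zero_smul, inner_zero_left, add_zero] at h
    rw [eq_neg_iff_add_eq_zero, ← integral_add, ← h]
    · refine integral_congr_ae ?_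
      filter_upwards [hA' y.fst] with t ht
      simp only [smul_apply, gelfand_apply, smul_eq_mul, ht, ContinuousLinearMap.flip_apply]
      rw [real_inner_comm]
    · exact (ContinuousLinearMap.apply ℝ ℝ ψ).integrable_comp hi
    · exact (ContinuousLinearMap.apply ℝ ℝ ψ).integrable_comp hi'
  obtain ⟨r, hr, he⟩ := hφ.exists_isRep hι hT
  -- `θ = t` vanishes at `0` but not at `T`. Comparing orthogonality with integration by parts
  -- leaves `T (ι ψ, r T) = 0`.
  have hrT : r T = 0 := by
    refine hdense _ fun ψ => ?_
    obtain ⟨f, g, hf, hg, hfg, hrep⟩ := exists_smul_const ι hT (θ := fun t => t)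
      (θ' := fun _ => 1) continuous_const (fun t => hasDerivAt_id t) ψ
    have h := integral_by_parts hι hT hfg hφ hrep hr
    have h' := horth' (θ := fun t => t) (θ' := fun _ => 1) continuous_const
      (fun t => hasDerivAt_id t) ψ
    simp only [zero_smul, inner_zero_left, add_zero, zero_add] at h h'
    have : ∫ t, (g t (y.fst t) + A' y.fst t (f t)) ∂(mu T) = 0 := by
      rw [← h']
      refine integral_congr_ae ?_
      filter_upwards [hf, hg, hA' y.fst] with t h1 h2 h3
      rw [h1, h2, h3]
      simp
    rw [this, real_inner_smul_left] at h
    exact (mul_eq_zero.1 h).resolve_left hT.ne'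
  have hy1 : y.fst = 0 := backward_unique hT hα hlam hco hr he (hA' y.fst) hrT
  -- With `y.fst = 0`, the choice `θ = 1` leaves only the initial value term `(ι ψ, y.snd)`.
  have hy2 : y.snd = 0 := by
    refine hdense _ fun ψ => ?_
    have h := horth' (θ := fun _ => 1) (θ' := fun _ => 0) continuous_const
      (fun t => hasDerivAt_const t 1) ψ
    rw [one_smul, integral_eq_zero_of_ae, zero_add] at h
    · exact h
    rw [hy1]
    filter_upwards [Lp.coeFn_zero V 2 (mu T)] with t ht
    rw [ht]
    simp
  exact WithLp.ofLp_injective 2 (Prod.ext hy1 hy2)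

/-- Well-posedness of parabolic initial value problems. -/
theorem bijective_parabolicOp [SecondCountableTopology V] [CompleteSpace H] [CompleteSpace W]
    (hι : Function.Injective ι)
    (hdense : ∀ h, (∀ ψ, inner ℝ (ι ψ) h = 0) → h = 0) (hT : 0 < T)
    (hα : 0 < α) (hlam : 0 ≤ lam) (hco : ∀ t x, α * ‖x‖ ^ 2 ≤ a t x x + lam * ‖ι x‖ ^ 2)
    (ha : ∀ x y, Measurable fun t => a t x y) {C : ℝ} (hC : ∀ t, ‖a t‖ ≤ C)
    (hA : ∀ f, ∀ᵐ t ∂(mu T), A f t = a t (f t))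
    (hW : ∀ w, IsTimeDeriv ι (val w) (dt w))
    (hW' : ∀ f g, IsTimeDeriv ι f g → ∃ w, val w = f ∧ dt w = g)
    (hnorm : ∀ w, ‖w‖ ^ 2 = ‖val w‖ ^ 2 + ‖dt w‖ ^ 2)
    (hτ : ∀ w r, IsRep ι (val w) r → r 0 = τ w) :
    Function.Bijective (parabolicOp val dt τ A) := by
  obtain ⟨A', hA', -⟩ := exists_superposition T (a := fun t => (a t).flip) (fun x y => ha y x)
    (fun t => (ContinuousLinearMap.opNorm_flip (a t)).trans_le (hC t))
  obtain ⟨K, hK⟩ := exists_norm_le_parabolicOp hι hT hα hlam hco hA hW hnorm hτ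
  have hanti : AntilipschitzWith K.toNNReal (parabolicOp val dt τ A) :=
    AddMonoidHomClass.antilipschitz_of_bound _ fun w => (hK w).trans
      (mul_le_mul_of_nonneg_right (Real.le_coe_toNNReal K) (norm_nonneg _))
  refine ⟨hanti.injective, LinearMap.range_eq_top.1 ?_⟩
  -- The lower bound closes the range. Since the target is a Hilbert space, after `V*` has been
  -- identified with `V`, surjectivity reduces to a trivial orthogonal complement.
  have hcl : IsClosed ((parabolicOp val dt τ A).range : Set (WithLp 2 (Lp V 2 (mu T) × H))) :=
    hanti.isClosed_range (parabolicOp val dt τ A).uniformContinuous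
  have : CompleteSpace (parabolicOp val dt τ A).range := hcl.completeSpace_coe
  rw [← Submodule.orthogonal_eq_bot_iff]
  exact orthogonal_range_parabolicOp hι hdense hT hα hlam hco hA hA' hW' hτ

end Solvability

/-! ### The Sobolev space on one edge -/

section SobolevSpace

variable {a : ℝ}

theorem secondCountable_L2 (a : ℝ) : SecondCountableTopology (L2 a) := by
  have : Fact ((2 : ENNReal) ≠ ⊤) := ⟨by simp⟩
  infer_instance

instance secondCountable_H1 (a : ℝ) : SecondCountableTopology (H1 a) := by
  have := secondCountable_L2 a
  exact inferInstanceAs (SecondCountableTopology (H1Sub a))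

instance completeSpace_H1 (a : ℝ) : CompleteSpace (H1 a) := by
  have h := isClosed_hasWeakDeriv (a := a) (ContinuousLinearMap.id ℝ ℝ)
  have h' : IsClosed (H1Sub a : Set (WithLp 2 (L2 a × L2 a))) := h
  exact h'.completeSpace_coe

/-- The underlying function as a bounded operator on `H¹(0, a)`. -/
def H1.valL (a : ℝ) : H1 a →L[ℝ] L2 a :=
  (WithLp.fstL 2 ℝ (L2 a) (L2 a)).comp (H1Sub a).subtypeL

/-- The weak derivative as a bounded operator on `H¹(0, a)`. -/
def H1.dxL (a : ℝ) : H1 a →L[ℝ] L2 a :=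
  (WithLp.sndL 2 ℝ (L2 a) (L2 a)).comp (H1Sub a).subtypeL

@[simp] theorem H1.valL_apply (φ : H1 a) : H1.valL a φ = φ.val := rfl

@[simp] theorem H1.dxL_apply (φ : H1 a) : H1.dxL a φ = φ.dx := rfl

theorem H1.hasWeakDeriv (φ : H1 a) : HasWeakDeriv a φ.val φ.dx := φ.2

theorem H1.norm_sq (φ : H1 a) : ‖φ‖ ^ 2 = ‖φ.val‖ ^ 2 + ‖φ.dx‖ ^ 2 :=
  WithLp.prod_norm_sq_eq_of_L2 φ.1

/-- Functions in `H¹(0, a)` have continuous representatives, and these are bounded by the norm. -/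
theorem H1.exists_continuousOn (ha : 0 < a) : ∃ C : ℝ, ∀ φ : H1 a, ∃ r : ℝ → ℝ,
    ContinuousOn r (Icc 0 a) ∧ φ.val =ᵐ[mu a] r ∧ ∀ x ∈ Icc 0 a, |r x| ≤ C * ‖φ‖ := by
  obtain ⟨K, hK0, hK⟩ := exists_integral_norm_le (mu a) ℝ
  refine ⟨a⁻¹ * (K * ‖H1.valL a‖) + 2 * (K * ‖H1.dxL a‖), fun φ => ?_⟩
  have hg := integrable_coeFn φ.dx
  obtain ⟨c, hc⟩ := φ.hasWeakDeriv.exists_ae_eq_primitive ha (integrable_coeFn φ.val) hg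
  have hp : ContinuousOn (fun t => ∫ s in (0 : ℝ)..t, φ.dx s) (Icc 0 a) := by
    simpa [uIcc_of_le ha.le] using intervalIntegral.continuousOn_primitive_interval'
      ((integrable_mu_iff ha.le).1 hg) left_mem_uIcc
  refine ⟨_, continuousOn_const.add hp, hc, fun x hx => ?_⟩
  have hv : ∫ s, |φ.val s| ∂(mu a) ≤ K * ‖H1.valL a‖ * ‖φ‖ :=
    (hK φ.val).trans (by
      rw [mul_assoc]; exact mul_le_mul_of_nonneg_left ((H1.valL a).le_opNorm φ) hK0)
  have hd : ∫ s, |φ.dx s| ∂(mu a) ≤ K * ‖H1.dxL a‖ * ‖φ‖ :=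
    (hK φ.dx).trans (by
      rw [mul_assoc]; exact mul_le_mul_of_nonneg_left ((H1.dxL a).le_opNorm φ) hK0)
  -- The one-sided bound is applied to the continuous representative and to its negative.
  have h1 := le_mean_add ha (e := fun t => c + ∫ s in (0 : ℝ)..t, φ.dx s) hg
    (fun t _ => by simp) hx
  have h2 := le_mean_add ha (e := fun t => -(c + ∫ s in (0 : ℝ)..t, φ.dx s)) hg.neg
    (fun t _ => by simp [intervalIntegral.integral_neg]; ring) hx
  have h3 : |∫ s, (c + ∫ t in (0 : ℝ)..s, φ.dx t) ∂(mu a)| ≤ ∫ s, |φ.val s| ∂(mu a) := by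
    rw [← integral_congr_ae hc]
    exact abs_integral_le_integral_abs
  simp only [Pi.neg_apply, abs_neg, integral_neg] at h2
  obtain ⟨h4, h5⟩ := abs_le.1 (h3.trans hv)
  have ha' := inv_pos.2 ha
  have h6 := mul_le_mul_of_nonneg_left h4 ha'.le
  have h7 := mul_le_mul_of_nonneg_left h5 ha'.le
  rw [abs_le, Pi.add_apply]
  constructor <;> linarith

/-- Point evaluation of the continuous representative as a bounded functional on `H¹(0, a)`. -/
theorem H1.exists_eval (ha : 0 < a) {x : ℝ} (hx : x ∈ Icc 0 a) : ∃ τ : H1 a →L[ℝ] ℝ,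
    ∀ (φ : H1 a) (r : ℝ → ℝ), ContinuousOn r (Icc 0 a) → φ.val =ᵐ[mu a] r → r x = τ φ := by
  obtain ⟨C, hC⟩ := H1.exists_continuousOn ha
  choose r hr hr' hb using hC
  have huniq : ∀ (φ : H1 a) (q : ℝ → ℝ), ContinuousOn q (Icc 0 a) → φ.val =ᵐ[mu a] q →
      q x = r φ x := fun φ q hq hq' => eqOn_Icc_of_ae_eq ha hq (hr φ) (hq'.symm.trans (hr' φ)) hx
  refine ⟨LinearMap.mkContinuous
    { toFun := fun φ => r φ x
      map_add' := fun φ ψ => by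
        refine (huniq (φ + ψ) (r φ + r ψ) ((hr φ).add (hr ψ)) ?_).symm
        exact (Lp.coeFn_add φ.val ψ.val).trans ((hr' φ).add (hr' ψ))
      map_smul' := fun c φ => by
        refine (huniq (c • φ) (c • r φ) ((hr φ).const_smul c) ?_).symm
        exact (Lp.coeFn_smul c φ.val).trans ((hr' φ).const_smul c) } C
    fun φ => hb φ x hx, huniq⟩

theorem IsTest.hasWeakDeriv {a : ℝ} (ha : 0 ≤ a) {η : ℝ → ℝ} (h : IsTest a η) :
    HasWeakDeriv a η (deriv η) :=
  hasWeakDeriv_primitive ha (h.continuous_deriv.intervalIntegrable _ _)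
    fun t _ => h.integral_deriv t

theorem memLp_mu_of_continuous {u : ℝ → ℝ} (hu : Continuous u) (a : ℝ) : MemLp u 2 (mu a) := by
  obtain ⟨C, hC⟩ := isCompact_Icc.exists_bound_of_continuousOn (s := Icc 0 a) hu.continuousOn
  refine MemLp.of_bound hu.aestronglyMeasurable C ?_
  filter_upwards [ae_restrict_mem measurableSet_Ioo] with t ht
  exact hC t (Ioo_subset_Icc_self ht)

/-- Test functions as elements of `H¹(0, a)`. -/
theorem IsTest.exists_H1 (ha : 0 ≤ a) {η : ℝ → ℝ} (h : IsTest a η) :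
    ∃ φ : H1 a, φ.val =ᵐ[mu a] η :=
  let h₀ := memLp_mu_of_continuous h.1.continuous a
  let h₁ := memLp_mu_of_continuous h.continuous_deriv a
  ⟨⟨WithLp.toLp 2 (h₀.toLp _, h₁.toLp _),
    (h.hasWeakDeriv ha).congr h₀.coeFn_toLp h₁.coeFn_toLp⟩, h₀.coeFn_toLp⟩

end SobolevSpace

/-! ### Function spaces on the star graph -/

section StarGraphSpaces

variable {N : ℕ} {l : Fin N → ℝ} {T : ℝ}

/-- The restriction of elements of `𝕍` to an edge. -/
def VV.edge (l : Fin N → ℝ) (i : Fin N) : VV l →L[ℝ] H1 (l i) :=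
  (PiLp.proj 2 (𝕜 := ℝ) (fun i => H1 (l i)) i).comp (VVSub l).subtypeL

/-- The components as bounded operators on `𝕍`. -/
def VV.compL (l : Fin N → ℝ) (i : Fin N) : VV l →L[ℝ] L2 (l i) := (H1.valL (l i)).comp (VV.edge l i)

/-- The derivatives of the components as bounded operators on `𝕍`. -/
def VV.dxL (l : Fin N → ℝ) (i : Fin N) : VV l →L[ℝ] L2 (l i) := (H1.dxL (l i)).comp (VV.edge l i)

@[simp] theorem VV.compL_apply (φ : VV l) (i : Fin N) : VV.compL l i φ = φ.comp i := rfl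

@[simp] theorem VV.dxL_apply (φ : VV l) (i : Fin N) : VV.dxL l i φ = φ.dx i := rfl

theorem VV.norm_sq (φ : VV l) : ‖φ‖ ^ 2 = ∑ i, (‖φ.comp i‖ ^ 2 + ‖φ.dx i‖ ^ 2) := by
  change ‖φ.1‖ ^ 2 = _
  rw [PiLp.norm_sq_eq_of_L2]
  exact Finset.sum_congr rfl fun i _ => H1.norm_sq (φ.1 i)

theorem norm_sq_toL2 (φ : VV l) : ‖toL2 l φ‖ ^ 2 = ∑ i, ‖φ.comp i‖ ^ 2 :=
  PiLp.norm_sq_eq_of_L2 _ _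

/-- Evaluation at an end point of an edge is a bounded functional on `H¹`, so the vertex conditions
are continuous linear equations. Completeness of `𝕍` follows. -/
theorem isClosed_VVSub (hl : ∀ i, 0 < l i) : IsClosed (VVSub l : Set (HH1 l)) := by
  choose τ₀ h₀ using fun i => H1.exists_eval (hl i) (left_mem_Icc.2 (hl i).le)
  choose τ₁ h₁ using fun i => H1.exists_eval (hl i) (right_mem_Icc.2 (hl i).le)
  choose C hC using fun i => H1.exists_continuousOn (hl i)
  have : (VVSub l : Set (HH1 l)) = {φ : HH1 l | (∀ i j, τ₀ i (φ i) = τ₀ j (φ j)) ∧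
      ∀ i, τ₁ i (φ i) = 0} := by
    ext φ
    constructor
    · rintro ⟨r, hr, k0, k1⟩
      refine ⟨fun i j => ?_, fun i => ?_⟩
      · rw [← h₀ i _ _ (hr i).1 (hr i).2, ← h₀ j _ _ (hr j).1 (hr j).2, k0 i j]
      · rw [← h₁ i _ _ (hr i).1 (hr i).2, k1 i]
    · rintro ⟨k0, k1⟩
      choose r hr hr' _ using fun i => hC i (φ i)
      refine ⟨r, fun i => ⟨hr i, hr' i⟩, fun i j => ?_, fun i => ?_⟩
      · rw [h₀ i _ _ (hr i) (hr' i), h₀ j _ _ (hr j) (hr' j), k0 i j]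
      · rw [h₁ i _ _ (hr i) (hr' i), k1 i]
  rw [this, ofPred_and, ofPred_forall, ofPred_forall]
  have hc : ∀ i, Continuous fun φ : HH1 l => φ i := fun i =>
    (PiLp.proj 2 (𝕜 := ℝ) (fun i => H1 (l i)) i).continuous
  refine IsClosed.inter (isClosed_iInter fun i => ?_) (isClosed_iInter fun i => ?_)
  · rw [ofPred_forall]
    exact isClosed_iInter fun j => isClosed_eq ((τ₀ i).continuous.comp (hc i))
      ((τ₀ j).continuous.comp (hc j))
  · exact isClosed_eq ((τ₁ i).continuous.comp (hc i)) continuous_const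

theorem completeSpace_VV (hl : ∀ i, 0 < l i) : CompleteSpace (VV l) :=
  (isClosed_VVSub hl).completeSpace_coe

instance secondCountable_VV (l : Fin N → ℝ) : SecondCountableTopology (VV l) :=
  inferInstanceAs (SecondCountableTopology (VVSub l))

/-- An element of `H¹` is a pair, so the derivative has to be shown to vanish as well: a weak
derivative is determined by its function. -/
theorem injective_toL2 (l : Fin N → ℝ) : Function.Injective (toL2 l) := by
  rw [injective_iff_map_eq_zero]
  intro φ h
  have hcomp : ∀ i, φ.comp i = 0 := fun i => congrArg (fun x : LL2 l => x i) h
  have hdx : ∀ i, φ.dx i = 0 := fun i => by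
    refine (Lp.eq_zero_iff_ae_eq_zero).2 (ae_eq_zero_of_integral_isTest_smul
      (integrable_coeFn _) fun η hη => ?_)
    have h1 := (φ.1 i).hasWeakDeriv η hη
    change ∫ s, deriv η s • φ.comp i s ∂_ = - ∫ s, η s • φ.dx i s ∂_ at h1
    rw [hcomp, integral_eq_zero_of_ae] at h1
    · exact neg_eq_zero.1 h1.symm
    · filter_upwards [Lp.coeFn_zero ℝ 2 (mu (l i))] with s hs
      rw [hs]
      simp
  have := VV.norm_sq φ
  simp only [hcomp, hdx, norm_zero] at this
  simpa using this

/-- The image of `𝕍` in `𝕃²` is dense. -/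
theorem eq_zero_of_inner_toL2 (hl : ∀ i, 0 < l i) (h : LL2 l)
    (h0 : ∀ ψ, inner ℝ (toL2 l ψ) h = 0) : h = 0 := by
  have : ∀ i, h i = 0 := fun i => by
    refine (Lp.eq_zero_iff_ae_eq_zero).2 (ae_eq_zero_of_integral_isTest_smul
      (integrable_coeFn _) fun η hη => ?_)
    obtain ⟨φ, hφ⟩ := hη.exists_H1 (hl i).le
    let r : Fin N → ℝ → ℝ := Pi.single i η
    -- A test function on the edge `i`, extended by zero to the other edges, vanishes at all
    -- vertices and so lies in `𝕍`.
    have hmem : WithLp.toLp 2 (Pi.single i φ) ∈ VVSub l := by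
      refine ⟨r, fun j => ?_, fun j k => ?_, fun j => ?_⟩
      · rcases eq_or_ne j i with rfl | hj
        · simp only [r, Pi.single_eq_same]
          exact ⟨hη.1.continuous.continuousOn, hφ⟩
        · simp only [r, Pi.single_eq_of_ne hj]
          exact ⟨continuousOn_const, Lp.coeFn_zero _ _ _⟩
      · have : ∀ j, r j 0 = 0 := fun j => by
          rcases eq_or_ne j i with rfl | hj
          · simpa [r] using hη.eq_zero_of_notMem (x := 0) (by simp)
          · simp [r, Pi.single_eq_of_ne hj]
        rw [this, this]
      · rcases eq_or_ne j i with rfl | hj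
        · simpa [r] using hη.eq_zero_of_notMem (x := l j) (by simp)
        · simp [r, Pi.single_eq_of_ne hj]
    have h1 := h0 ⟨_, hmem⟩
    rw [PiLp.inner_apply, Finset.sum_eq_single i] at h1
    · rw [L2.inner_def] at h1
      rw [← h1]
      refine integral_congr_ae ?_
      have : (toL2 l ⟨_, hmem⟩ i : L2 (l i)) = φ.val := by
        change ((Pi.single i φ : ∀ i, H1 (l i)) i).val = _
        rw [Pi.single_eq_same]
      rw [this]
      filter_upwards [hφ] with s hs
      rw [hs]
      simp [mul_comm]
    · intro j _ hj
      have : (toL2 l ⟨_, hmem⟩ j : L2 (l j)) = 0 := by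
        change ((Pi.single i φ : ∀ i, H1 (l i)) j).val = _
        rw [Pi.single_eq_of_ne hj]
        rfl
      rw [this, inner_zero_left]
    · simp
  ext1 i
  exact this i

/-- The embedding `𝕎(0, T) → L²(0, T; 𝕍)`. -/
def WW.valL (l : Fin N → ℝ) (T : ℝ) : WW l T →L[ℝ] Lp (VV l) 2 (mu T) :=
  (WithLp.fstL 2 ℝ (Lp (VV l) 2 (mu T)) (Lp (VVdual l) 2 (mu T))).comp (WWSub l T).subtypeL

/-- The time derivative as a bounded operator on `𝕎(0, T)`. -/
def WW.dtL (l : Fin N → ℝ) (T : ℝ) : WW l T →L[ℝ] Lp (VVdual l) 2 (mu T) :=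
  (WithLp.sndL 2 ℝ (Lp (VV l) 2 (mu T)) (Lp (VVdual l) 2 (mu T))).comp (WWSub l T).subtypeL

theorem WW.norm_sq (ρ : WW l T) : ‖ρ‖ ^ 2 = ‖WW.valL l T ρ‖ ^ 2 + ‖WW.dtL l T ρ‖ ^ 2 :=
  WithLp.prod_norm_sq_eq_of_L2 ρ.1

theorem WW.isTimeDeriv (ρ : WW l T) : IsTimeDeriv (toL2 l) (WW.valL l T ρ) (WW.dtL l T ρ) := ρ.2

theorem WW.exists_of_isTimeDeriv {f : Lp (VV l) 2 (mu T)} {g : Lp (VVdual l) 2 (mu T)}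
    (h : IsTimeDeriv (toL2 l) f g) : ∃ ρ : WW l T, WW.valL l T ρ = f ∧ WW.dtL l T ρ = g :=
  ⟨⟨WithLp.toLp 2 (f, g), h⟩, rfl, rfl⟩

theorem completeSpace_WW (hl : ∀ i, 0 < l i) (T : ℝ) : CompleteSpace (WW l T) := by
  have := completeSpace_VV hl
  have h : IsClosed (WWSub l T : Set (WithLp 2 (Lp (VV l) 2 (mu T) × Lp (VVdual l) 2 (mu T)))) :=
    isClosed_hasWeakDeriv (a := T) (toDual l)
  exact h.completeSpace_coe

end StarGraphSpaces

/-! ### Multiplication by a bounded function as a bilinear form -/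

section MultiplicationForm

variable {a : ℝ}

theorem integrable_mul_mul {m : ℝ → ℝ} (hm : AEStronglyMeasurable m (mu a)) {C : ℝ}
    (hC : ∀ᵐ x ∂(mu a), |m x| ≤ C) (f g : L2 a) :
    Integrable (fun x => m x * f x * g x) (mu a) := by
  have h : Integrable (fun x => f x * g x) (mu a) :=
    (Lp.memLp f).integrable_mul (Lp.memLp g)
  simpa only [mul_assoc] using h.bdd_mul (c := C) hm hC

/-- The bilinear form `(f, g) ↦ ∫ m f g` on `L²(0, a)` for a bounded function `m`. -/
def mulForm {m : ℝ → ℝ} (hm : Measurable m) {C : ℝ} (hC : ∀ x, |m x| ≤ C) :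
    L2 a →L[ℝ] L2 a →L[ℝ] ℝ :=
  LinearMap.mkContinuous₂ (LinearMap.mk₂ ℝ (fun f g : L2 a => ∫ x, m x * f x * g x ∂(mu a))
    (fun f f' g => by
      rw [← integral_add
        (integrable_mul_mul hm.aestronglyMeasurable (Eventually.of_forall hC) f g)
        (integrable_mul_mul hm.aestronglyMeasurable (Eventually.of_forall hC) f' g)]
      refine integral_congr_ae ?_
      filter_upwards [Lp.coeFn_add f f'] with x hx
      rw [hx, Pi.add_apply]
      ring)
    (fun c f g => by
      rw [smul_eq_mul, ← integral_const_mul]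
      refine integral_congr_ae ?_
      filter_upwards [Lp.coeFn_smul c f] with x hx
      rw [hx, Pi.smul_apply, smul_eq_mul]
      ring)
    (fun f g g' => by
      rw [← integral_add
        (integrable_mul_mul hm.aestronglyMeasurable (Eventually.of_forall hC) f g)
        (integrable_mul_mul hm.aestronglyMeasurable (Eventually.of_forall hC) f g')]
      refine integral_congr_ae ?_
      filter_upwards [Lp.coeFn_add g g'] with x hx
      rw [hx, Pi.add_apply]
      ring)
    (fun c f g => by
      rw [smul_eq_mul, ← integral_const_mul]
      refine integral_congr_ae ?_
      filter_upwards [Lp.coeFn_smul c g] with x hx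
      rw [hx, Pi.smul_apply, smul_eq_mul]
      ring)) C (fun f g => by
    have hC0 : 0 ≤ C := (abs_nonneg _).trans (hC 0)
    refine (norm_integral_le_integral_norm _).trans ?_
    rw [mul_assoc]
    refine le_trans ?_ (mul_le_mul_of_nonneg_left (integral_norm_mul_norm_le f g) hC0)
    rw [← integral_const_mul]
    refine integral_mono_of_nonneg (Eventually.of_forall fun x => norm_nonneg _)
      ((integrable_norm_mul_norm f g).const_mul C) (Eventually.of_forall fun x => ?_)
    simp only [norm_mul, mul_assoc]
    exact mul_le_mul_of_nonneg_right (hC x) (by positivity))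

theorem mulForm_apply {m : ℝ → ℝ} (hm : Measurable m) {C : ℝ} (hC : ∀ x, |m x| ≤ C) (f g : L2 a) :
    mulForm hm hC f g = ∫ x, m x * f x * g x ∂(mu a) := rfl

theorem abs_mulForm_le {m : ℝ → ℝ} (hm : Measurable m) {C : ℝ} (hC : ∀ x, |m x| ≤ C) (f g : L2 a) :
    |mulForm hm hC f g| ≤ C * ‖f‖ * ‖g‖ := by
  have hC0 : 0 ≤ C := (abs_nonneg _).trans (hC 0)
  refine ((mulForm hm hC).le_opNorm₂ f g).trans ?_
  gcongr
  exact LinearMap.mkContinuous₂_norm_le _ hC0 _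

end MultiplicationForm

theorem exists_continuousLinearMap {E F : Type*} [NormedAddCommGroup E] [NormedSpace ℝ E]
    [NormedAddCommGroup F] [NormedSpace ℝ F] {B : E → F} (hadd : ∀ x y, B (x + y) = B x + B y)
    (hsmul : ∀ (c : ℝ) x, B (c • x) = c • B x) {C : ℝ} (hC : ∀ x, ‖B x‖ ≤ C * ‖x‖) :
    ∃ L : E →L[ℝ] F, ∀ x, L x = B x :=
  ⟨LinearMap.mkContinuous { toFun := B, map_add' := hadd, map_smul' := hsmul } C hC,
    fun _ => rfl⟩

/-! ### Drift and diffusion forms, Gårding inequality -/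

section Forms

variable {N : ℕ} {l : Fin N → ℝ} {T : ℝ}

/-- Fubini for null sets. The coordinates are swapped first, because time is the second one and has
to become the outer variable. -/
theorem ae_ae_of_ae_cylinder {b : ℝ} {P : ℝ × ℝ → Prop}
    (h : ∀ᵐ z ∂((volume : Measure (ℝ × ℝ)).restrict (Ioo 0 b ×ˢ Ioo 0 T)), P z) :
    ∀ᵐ t ∂(mu T), ∀ᵐ x ∂(mu b), P (x, t) := by
  rw [Measure.volume_eq_prod, ← Measure.prod_restrict, ← Measure.prod_swap] at h
  exact Measure.ae_ae_of_ae_prod (ae_of_ae_map measurable_swap.aemeasurable h)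

/-- A bounded measurable representative of the control on the edge `i`. -/
def bddRep (u : LLinf l T) (i : Fin N) (z : ℝ × ℝ) : ℝ := max (-‖u i‖) (min ‖u i‖ (u i z))

theorem abs_bddRep_le (u : LLinf l T) (i : Fin N) (z : ℝ × ℝ) : |bddRep u i z| ≤ ‖u i‖ :=
  abs_le.2 ⟨le_max_left _ _, max_le (neg_le_self (norm_nonneg _)) (min_le_left _ _)⟩

theorem measurable_bddRep (u : LLinf l T) (i : Fin N) : Measurable (bddRep u i) :=
  measurable_const.max (measurable_const.min (Lp.stronglyMeasurable (u i)).measurable)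

/-- Truncation at the essential supremum changes `u` only on a null set of the cylinder. In exchange
the bound holds at every point, so `driftForm u t` is a bounded form for every `t`, not just for
almost every one. -/
theorem bddRep_ae_eq (u : LLinf l T) : ∀ᵐ t ∂(mu T), ∀ i, ∀ᵐ x ∂(mu (l i)),
    bddRep u i (x, t) = u i (x, t) := by
  rw [ae_all_iff]
  intro i
  refine ae_ae_of_ae_cylinder (P := fun z => bddRep u i z = u i z) ?_
  have h : ∀ᵐ z ∂((volume : Measure (ℝ × ℝ)).restrict (Ioo 0 (l i) ×ˢ Ioo 0 T)),
      ‖u i z‖ ≤ ‖u i‖ := by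
    have h1 := ae_le_eLpNormEssSup (f := u i)
      (μ := (volume : Measure (ℝ × ℝ)).restrict (Ioo 0 (l i) ×ˢ Ioo 0 T))
    filter_upwards [h1] with z hz
    rw [← eLpNorm_exponent_top] at hz
    rw [Lp.norm_def, ← toReal_enorm]
    exact ENNReal.toReal_mono (Lp.eLpNorm_ne_top _) hz
  filter_upwards [h] with z hz
  obtain ⟨h1, h2⟩ := abs_le.1 hz
  rw [bddRep, min_eq_right h2, max_eq_right h1]

theorem measurable_bddRep_left (u : LLinf l T) (i : Fin N) (t : ℝ) :
    Measurable fun x => bddRep u i (x, t) :=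
  (measurable_bddRep u i).comp measurable_prodMk_right

/-- The form `∑ ∫ u_i ρ_i ∂_x φ_i dx` at time `t`. -/
def driftForm (u : LLinf l T) (t : ℝ) : VV l →L[ℝ] VV l →L[ℝ] ℝ :=
  ∑ i, (mulForm (measurable_bddRep_left u i t) fun x => abs_bddRep_le u i (x, t)).bilinearComp
    (VV.compL l i) (VV.dxL l i)

/-- The form `∑ D_i ∫ ∂_x ρ_i ∂_x φ_i dx`. -/
def diffusionForm (l D : Fin N → ℝ) : VV l →L[ℝ] VV l →L[ℝ] ℝ :=
  ∑ i, D i • gelfand (VV.dxL l i)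

theorem driftForm_apply (u : LLinf l T) (t : ℝ) (ρ φ : VV l) :
    driftForm u t ρ φ = ∑ i, ∫ x, bddRep u i (x, t) * ρ.comp i x * φ.dx i x ∂(mu (l i)) := by
  simp only [driftForm, sum_apply, ContinuousLinearMap.bilinearComp_apply, mulForm_apply,
    VV.compL_apply, VV.dxL_apply]

theorem diffusionForm_apply (l D : Fin N → ℝ) (ρ φ : VV l) :
    diffusionForm l D ρ φ = ∑ i, ∫ x, D i * ρ.dx i x * φ.dx i x ∂(mu (l i)) := by
  simp only [diffusionForm, sum_apply, smul_apply, gelfand_apply, VV.dxL_apply]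
  refine Finset.sum_congr rfl fun i _ => ?_
  rw [L2.inner_def, smul_eq_mul, ← integral_const_mul]
  refine integral_congr_ae (Eventually.of_forall fun x => ?_)
  simp only [RCLike.inner_apply, conj_trivial]
  ring

/-- The exceptional set of times comes from `u` alone and hence is the same for all `ρ` and `φ`. -/
theorem form_ae_eq (D : Fin N → ℝ) (u : LLinf l T) : ∀ᵐ t ∂(mu T), ∀ ρ φ : VV l,
    form D u t ρ φ = (diffusionForm l D + driftForm u t) ρ φ := by
  filter_upwards [bddRep_ae_eq u] with t ht ρ φ
  rw [add_apply, add_apply, driftForm_apply, diffusionForm_apply, ← Finset.sum_add_distrib, form]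
  refine Finset.sum_congr rfl fun i _ => ?_
  rw [← integral_add (integrable_mul_mul (m := fun _ => D i) aestronglyMeasurable_const
    (C := |D i|) (Eventually.of_forall fun _ => le_rfl) _ _)
    (integrable_mul_mul (m := fun x => bddRep u i (x, t))
      (measurable_bddRep_left u i t).aestronglyMeasurable
      (Eventually.of_forall fun x => abs_bddRep_le u i (x, t)) _ _)]
  refine integral_congr_ae ?_
  filter_upwards [ht i] with x hx
  rw [hx]
  ring

theorem dFun_ae_eq (v : LLinf l T) : ∀ᵐ t ∂(mu T), ∀ ρ φ : VV l,
    dFun (fun i x => ρ.comp i x * v i (x, t)) φ = - driftForm v t ρ φ := by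
  filter_upwards [bddRep_ae_eq v] with t ht ρ φ
  rw [driftForm_apply, dFun]
  congr 1
  refine Finset.sum_congr rfl fun i _ => integral_congr_ae ?_
  filter_upwards [ht i] with x hx
  rw [hx]
  ring

/-- Truncated representatives need not add up pointwise; they do so only where they agree with the
controls. Additivity for almost every `t` is enough for operators on `L²(0, T; 𝕍)`. -/
theorem driftForm_add (u v : LLinf l T) : ∀ᵐ t ∂(mu T),
    driftForm (u + v) t = driftForm u t + driftForm v t := by
  have h : ∀ᵐ t ∂(mu T), ∀ i, ∀ᵐ x ∂(mu (l i)), (u + v) i (x, t) = u i (x, t) + v i (x, t) :=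
    ae_all_iff.2 fun i => ae_ae_of_ae_cylinder (Lp.coeFn_add (u i) (v i))
  filter_upwards [bddRep_ae_eq u, bddRep_ae_eq v, bddRep_ae_eq (u + v), h] with t h1 h2 h3 h4
  ext ρ φ
  rw [add_apply, add_apply, driftForm_apply, driftForm_apply, driftForm_apply,
    ← Finset.sum_add_distrib]
  refine Finset.sum_congr rfl fun i _ => ?_
  rw [← integral_add
    (integrable_mul_mul (m := fun x => bddRep u i (x, t))
      (measurable_bddRep_left u i t).aestronglyMeasurable
      (Eventually.of_forall fun x => abs_bddRep_le u i (x, t)) _ _)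
    (integrable_mul_mul (m := fun x => bddRep v i (x, t))
      (measurable_bddRep_left v i t).aestronglyMeasurable
      (Eventually.of_forall fun x => abs_bddRep_le v i (x, t)) _ _)]
  refine integral_congr_ae ?_
  filter_upwards [h1 i, h2 i, h3 i, h4 i] with x k1 k2 k3 k4
  rw [k3, k4, k1, k2]
  ring

theorem driftForm_smul (c : ℝ) (u : LLinf l T) : ∀ᵐ t ∂(mu T),
    driftForm (c • u) t = c • driftForm u t := by
  have h : ∀ᵐ t ∂(mu T), ∀ i, ∀ᵐ x ∂(mu (l i)), (c • u) i (x, t) = c * u i (x, t) :=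
    ae_all_iff.2 fun i => ae_ae_of_ae_cylinder (Lp.coeFn_smul c (u i))
  filter_upwards [bddRep_ae_eq u, bddRep_ae_eq (c • u), h] with t h1 h3 h4
  ext ρ φ
  rw [smul_apply, smul_apply, driftForm_apply, driftForm_apply, Finset.smul_sum]
  refine Finset.sum_congr rfl fun i _ => ?_
  rw [smul_eq_mul, ← integral_const_mul]
  refine integral_congr_ae ?_
  filter_upwards [h1 i, h3 i, h4 i] with x k1 k3 k4
  rw [k3, k4, k1]
  ring

theorem VV.norm_comp_le_norm (φ : VV l) (i : Fin N) : ‖φ.comp i‖ ≤ ‖φ‖ := by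
  refine (sq_le_sq₀ (norm_nonneg _) (norm_nonneg _)).1 ?_
  rw [VV.norm_sq]
  exact (le_add_of_nonneg_right (sq_nonneg _)).trans
    (Finset.single_le_sum (f := fun i => ‖φ.comp i‖ ^ 2 + ‖φ.dx i‖ ^ 2)
      (fun j _ => by positivity) (Finset.mem_univ i))

theorem VV.norm_dx_le_norm (φ : VV l) (i : Fin N) : ‖φ.dx i‖ ≤ ‖φ‖ := by
  refine (sq_le_sq₀ (norm_nonneg _) (norm_nonneg _)).1 ?_
  rw [VV.norm_sq]
  exact (le_add_of_nonneg_left (sq_nonneg _)).trans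
    (Finset.single_le_sum (f := fun i => ‖φ.comp i‖ ^ 2 + ‖φ.dx i‖ ^ 2)
      (fun j _ => by positivity) (Finset.mem_univ i))

theorem norm_driftForm_le (u : LLinf l T) (t : ℝ) : ‖driftForm u t‖ ≤ ‖u‖ := by
  refine ContinuousLinearMap.opNorm_le_bound₂ _ (norm_nonneg _) fun ρ φ => ?_
  rw [PiLp.norm_eq_of_L1, Finset.sum_mul, Finset.sum_mul, driftForm, sum_apply, sum_apply]
  refine (norm_sum_le _ _).trans (Finset.sum_le_sum fun i _ => ?_)
  refine (abs_mulForm_le (measurable_bddRep_left u i t) (fun x => abs_bddRep_le u i (x, t))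
    (ρ.comp i) (φ.dx i)).trans ?_
  have h1 := ρ.norm_comp_le_norm i
  have h2 := φ.norm_dx_le_norm i
  gcongr

theorem norm_diffusionForm_add_driftForm_le (D : Fin N → ℝ) (u : LLinf l T) (t : ℝ) :
    ‖diffusionForm l D + driftForm u t‖ ≤ ‖diffusionForm l D‖ + ‖u‖ :=
  (ContinuousLinearMap.opNorm_add_le _ _).trans (by grw [norm_driftForm_le])

theorem measurable_driftForm (u : LLinf l T) (ρ φ : VV l) :
    Measurable fun t => driftForm u t ρ φ := by
  simp only [driftForm_apply]
  refine Finset.measurable_sum _ fun i _ => ?_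
  have h : StronglyMeasurable fun z : ℝ × ℝ => bddRep u i z * ρ.comp i z.1 * φ.dx i z.1 :=
    ((measurable_bddRep u i).stronglyMeasurable.mul
      ((Lp.stronglyMeasurable (ρ.comp i)).comp_measurable measurable_fst)).mul
      ((Lp.stronglyMeasurable (φ.dx i)).comp_measurable measurable_fst)
  exact h.integral_prod_left'.measurable

/-- The Gårding inequality. -/
theorem garding {D : Fin N → ℝ} {d : ℝ} (hd : 0 < d) (hD : ∀ i, d ≤ D i) (u : LLinf l T) (t : ℝ)
    (φ : VV l) : d / 2 * ‖φ‖ ^ 2 ≤ (diffusionForm l D + driftForm u t) φ φ +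
      (‖u‖ ^ 2 / (2 * d) + d / 2) * ‖toL2 l φ‖ ^ 2 := by
  have hdrift : ∀ i, -(‖u‖ ^ 2 / (2 * d) * ‖φ.comp i‖ ^ 2 + d / 2 * ‖φ.dx i‖ ^ 2) ≤
      mulForm (measurable_bddRep_left u i t) (fun x => abs_bddRep_le u i (x, t))
        (φ.comp i) (φ.dx i) := fun i => by
    refine le_trans (neg_le_neg ?_) (neg_le_of_abs_le (abs_mulForm_le _ _ _ _))
    have h1 : ‖u i‖ * ‖φ.comp i‖ * ‖φ.dx i‖ ≤ ‖u‖ * ‖φ.comp i‖ * ‖φ.dx i‖ := by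
      have := PiLp.norm_apply_le u i
      gcongr
    refine h1.trans ?_
    -- Completing the square: half of the diffusion absorbs the drift at the cost of `‖u‖² / (2 d)`
    -- times the `L²` norm squared. The extra `d / 2` in the constant of the lemma completes the
    -- remaining `d / 2 ‖∂_x φ‖²` to the full norm of `𝕍`.
    have h2 : ‖u‖ ^ 2 / (2 * d) * ‖φ.comp i‖ ^ 2 + d / 2 * ‖φ.dx i‖ ^ 2 -
        ‖u‖ * ‖φ.comp i‖ * ‖φ.dx i‖ = (‖u‖ * ‖φ.comp i‖ - d * ‖φ.dx i‖) ^ 2 / (2 * d) := by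
      field_simp
      ring
    have h3 : 0 ≤ (‖u‖ * ‖φ.comp i‖ - d * ‖φ.dx i‖) ^ 2 / (2 * d) := by positivity
    linarith
  rw [VV.norm_sq, norm_sq_toL2, add_apply, add_apply, diffusionForm, driftForm]
  simp only [sum_apply, smul_apply, gelfand_apply, ContinuousLinearMap.bilinearComp_apply,
    VV.compL_apply, VV.dxL_apply, real_inner_self_eq_norm_sq, smul_eq_mul]
  rw [Finset.mul_sum, Finset.mul_sum, ← Finset.sum_add_distrib, ← Finset.sum_add_distrib]
  refine Finset.sum_le_sum fun i _ => ?_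
  have h1 := hdrift i
  have h2 := mul_le_mul_of_nonneg_right (hD i) (sq_nonneg ‖φ.dx i‖)
  linarith

/-- The drift as a bounded operator depending linearly on the control. -/
theorem exists_driftOp (hl : ∀ i, 0 < l i) (T : ℝ) :
    ∃ B : LLinf l T →L[ℝ] Lp (VV l) 2 (mu T) →L[ℝ] Lp (VVdual l) 2 (mu T),
      ∀ u f, ∀ᵐ t ∂(mu T), B u f t = driftForm u t (f t) := by
  have := completeSpace_VV hl
  choose B hB hBn using fun u : LLinf l T =>
    exists_superposition T (measurable_driftForm u) (norm_driftForm_le u)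
  have hadd : ∀ u v, B (u + v) = B u + B v := fun u v => ContinuousLinearMap.ext fun f => by
    refine Lp.ext ?_
    rw [add_apply]
    filter_upwards [hB (u + v) f, hB u f, hB v f, driftForm_add u v,
      Lp.coeFn_add (B u f) (B v f)] with t h1 h2 h3 h4 h5
    rw [h1, h4, add_apply, h5, Pi.add_apply, h2, h3]
  have hsmul : ∀ (c : ℝ) u, B (c • u) = c • B u := fun c u => ContinuousLinearMap.ext fun f => by
    refine Lp.ext ?_
    rw [smul_apply]
    filter_upwards [hB (c • u) f, hB u f, driftForm_smul c u,
      Lp.coeFn_smul c (B u f)] with t h1 h2 h3 h4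
    rw [h1, h3, smul_apply, h4, Pi.smul_apply, h2]
  have hnorm : ∀ u, ‖B u‖ ≤ 1 * ‖u‖ := fun u => by
    rw [one_mul]
    exact ContinuousLinearMap.opNorm_le_bound _ (norm_nonneg _) (hBn u)
  obtain ⟨L, hL⟩ := exists_continuousLinearMap (B := B)
    (F := Lp (VV l) 2 (mu T) →L[ℝ] Lp (VVdual l) 2 (mu T)) (C := 1) hadd hsmul hnorm
  refine ⟨L, fun u f => ?_⟩
  rw [hL]
  exact hB u f

end Forms

/-- Solutions of a linear equation depend differentiably on a parameter that enters the operator in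
an affine way. -/
theorem exists_differentiable_solution {X W Y : Type*} [NormedAddCommGroup X] [NormedSpace ℝ X]
    [NormedAddCommGroup W] [NormedSpace ℝ W] [CompleteSpace W] [NormedAddCommGroup Y]
    [NormedSpace ℝ Y] [CompleteSpace Y] (A : W →L[ℝ] Y) (M : X →L[ℝ] W →L[ℝ] Y)
    (h : ∀ u, Function.Bijective (A + M u)) (y : Y) :
    ∃ G : X → W, (∀ u w, (A + M u) w = y ↔ w = G u) ∧ ∀ u, DifferentiableAt ℝ G u ∧
      ∀ v z, (A + M u) z = -(M v (G u)) ↔ z = fderiv ℝ G u v := by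
  let e : X → W ≃L[ℝ] Y := fun u => ContinuousLinearEquiv.ofBijective (A + M u)
    (LinearMap.ker_eq_bot.2 (h u).1) (LinearMap.range_eq_top.2 (h u).2)
  have he : ∀ u, (e u : W →L[ℝ] Y) = A + M u := fun u => by
    ext w
    rfl
  let G : X → W := fun u => (A + M u).inverse y
  have hG : ∀ u, G u = (e u).symm y := fun u => by
    change (A + M u).inverse y = _
    rw [← he, ContinuousLinearMap.inverse_equiv]
    rfl
  have hAG : ∀ u, (A + M u) (G u) = y := fun u => by
    rw [hG, ← he]
    exact (e u).apply_symm_apply y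
  have hAd : ∀ u, HasFDerivAt (fun u => A + M u) M u := fun u => M.hasFDerivAt.const_add A
  have hd : ∀ u, DifferentiableAt ℝ G u := fun u => by
    -- Inversion is smooth at isomorphisms, and `A + M u` is one by the open mapping theorem.
    have h1 : DifferentiableAt ℝ ContinuousLinearMap.inverse (A + M u) := by
      rw [← he]
      exact (contDiffAt_map_inverse (n := 1) (e u)).differentiableAt (by simp)
    exact (h1.comp u (hAd u).differentiableAt).clm_apply (differentiableAt_const y)
  refine ⟨G, fun u w => ⟨fun hw => (h u).1 (hw.trans (hAG u).symm), fun hw => hw ▸ hAG u⟩,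
    fun u => ⟨hd u, fun v z => ?_⟩⟩
  -- The identity `(A + M u) (G u) = y` is differentiated in `u`; its right-hand side is constant.
  have h1 := (hAd u).clm_apply (hd u).hasFDerivAt
  have h2 : HasFDerivAt (fun u => (A + M u) (G u)) (0 : X →L[ℝ] Y) u := by
    simp only [hAG]
    exact hasFDerivAt_const y u
  have h3 := congrArg (fun L : X →L[ℝ] Y => L v) (h1.unique h2)
  have h4 : (A + M u) (fderiv ℝ G u v) + M v (G u) = 0 := h3
  rw [← eq_neg_of_add_eq_zero_left h4]
  exact (h u).1.eq_iff

/-! ### The control-to-state map of an abstract parabolic problem -/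

section Perturbation

variable {V H W : Type*} [NormedAddCommGroup V] [InnerProductSpace ℝ V] [CompleteSpace V]
  [NormedAddCommGroup H] [InnerProductSpace ℝ H]
  [NormedAddCommGroup W] [NormedSpace ℝ W] {T : ℝ}

/-- Perturbing the spatial operator changes only the first component, and does so linearly and
continuously. This is the affine dependence that `exists_differentiable_solution` requires. -/
theorem exists_parabolicOp_add (val : W →L[ℝ] Lp V 2 (mu T))
    (dt : W →L[ℝ] Lp (V →L[ℝ] ℝ) 2 (mu T)) (τ : W →L[ℝ] H)
    (A : Lp V 2 (mu T) →L[ℝ] Lp (V →L[ℝ] ℝ) 2 (mu T)) :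
    ∃ J : (Lp V 2 (mu T) →L[ℝ] Lp (V →L[ℝ] ℝ) 2 (mu T)) →L[ℝ]
        W →L[ℝ] WithLp 2 (Lp V 2 (mu T) × H),
      (∀ B, parabolicOp val dt τ (A + B) = parabolicOp val dt τ A + J B) ∧
      ∀ B w, J B w = WithLp.toLp 2
        (((riesz V).symm.toContinuousLinearEquiv : (V →L[ℝ] ℝ) →L[ℝ] V).compLpL 2 (mu T)
          (B (val w)), 0) := by
  let R : Lp (V →L[ℝ] ℝ) 2 (mu T) →L[ℝ] WithLp 2 (Lp V 2 (mu T) × H) :=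
    ((WithLp.prodContinuousLinearEquiv 2 ℝ (Lp V 2 (mu T)) H).symm :
      (Lp V 2 (mu T) × H) →L[ℝ] WithLp 2 (Lp V 2 (mu T) × H)).comp
      ((ContinuousLinearMap.inl ℝ (Lp V 2 (mu T)) H).comp
        (((riesz V).symm.toContinuousLinearEquiv : (V →L[ℝ] ℝ) →L[ℝ] V).compLpL 2 (mu T)))
  let J : (Lp V 2 (mu T) →L[ℝ] Lp (V →L[ℝ] ℝ) 2 (mu T)) →L[ℝ]
      W →L[ℝ] WithLp 2 (Lp V 2 (mu T) × H) :=
    (ContinuousLinearMap.compL ℝ W (Lp (V →L[ℝ] ℝ) 2 (mu T)) _ R).comp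
      ((ContinuousLinearMap.compL ℝ W (Lp V 2 (mu T)) (Lp (V →L[ℝ] ℝ) 2 (mu T))).flip val)
  have hJ : ∀ B w, J B w = WithLp.toLp 2
      (((riesz V).symm.toContinuousLinearEquiv : (V →L[ℝ] ℝ) →L[ℝ] V).compLpL 2 (mu T)
        (B (val w)), 0) := fun B w => rfl
  refine ⟨J, fun B => ContinuousLinearMap.ext fun w => ?_, hJ⟩
  rw [add_apply, hJ, parabolicOp_apply, parabolicOp_apply, ← WithLp.toLp_add, Prod.mk_add_mk,
    add_zero, ← map_add, add_apply, add_assoc]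

theorem riesz_symm_compLpL_injective : Function.Injective
    (((riesz V).symm.toContinuousLinearEquiv : (V →L[ℝ] ℝ) →L[ℝ] V).compLpL 2 (mu T)) := by
  rw [injective_iff_map_eq_zero]
  intro g hg
  rw [← norm_eq_zero, ← norm_riesz_symm_compLpL, hg, norm_zero]

theorem parabolicOp_eq_iff {val : W →L[ℝ] Lp V 2 (mu T)}
    {dt : W →L[ℝ] Lp (V →L[ℝ] ℝ) 2 (mu T)} {τ : W →L[ℝ] H}
    {A : Lp V 2 (mu T) →L[ℝ] Lp (V →L[ℝ] ℝ) 2 (mu T)} {w : W}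
    {g : Lp (V →L[ℝ] ℝ) 2 (mu T)} {x : H} :
    parabolicOp val dt τ A w = WithLp.toLp 2
      (((riesz V).symm.toContinuousLinearEquiv : (V →L[ℝ] ℝ) →L[ℝ] V).compLpL 2 (mu T) g, x) ↔
      dt w + A (val w) = g ∧ τ w = x := by
  rw [parabolicOp_apply, (WithLp.toLp_injective 2).eq_iff, Prod.mk.injEq,
    riesz_symm_compLpL_injective.eq_iff]

/-- The control-to-state map of a parabolic problem with a control that enters the operator in an
affine way. -/
theorem exists_controlToState [CompleteSpace H] [CompleteSpace W] {X : Type*}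
    [NormedAddCommGroup X] [NormedSpace ℝ X] {val : W →L[ℝ] Lp V 2 (mu T)}
    {dt : W →L[ℝ] Lp (V →L[ℝ] ℝ) 2 (mu T)} {τ : W →L[ℝ] H}
    (A : Lp V 2 (mu T) →L[ℝ] Lp (V →L[ℝ] ℝ) 2 (mu T))
    (B : X →L[ℝ] Lp V 2 (mu T) →L[ℝ] Lp (V →L[ℝ] ℝ) 2 (mu T))
    (h : ∀ u, Function.Bijective (parabolicOp val dt τ (A + B u))) (x : H) :
    ∃ G : X → W, (∀ u w, dt w + (A + B u) (val w) = 0 ∧ τ w = x ↔ w = G u) ∧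
      ∀ u, DifferentiableAt ℝ G u ∧ ∀ v z,
        dt z + (A + B u) (val z) = -B v (val (G u)) ∧ τ z = 0 ↔ z = fderiv ℝ G u v := by
  obtain ⟨J, hJ, hJ'⟩ := exists_parabolicOp_add val dt τ A
  obtain ⟨G, hG, hG'⟩ := exists_differentiable_solution (parabolicOp val dt τ A) (J.comp B)
    (fun u => by
      rw [ContinuousLinearMap.comp_apply, ← hJ]
      exact h u) (WithLp.toLp 2 (0, x))
  refine ⟨G, fun u w => ?_, fun u => ⟨(hG' u).1, fun v z => ?_⟩⟩
  · have e : (WithLp.toLp 2 (0, x) : WithLp 2 (Lp V 2 (mu T) × H)) = WithLp.toLp 2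
        (((riesz V).symm.toContinuousLinearEquiv : (V →L[ℝ] ℝ) →L[ℝ] V).compLpL 2 (mu T) 0, x) := by
      rw [map_zero]
    rw [← hG u w, ContinuousLinearMap.comp_apply, ← hJ, e]
    exact parabolicOp_eq_iff.symm
  · have e : -(J (B v) (G u)) = WithLp.toLp 2
        (((riesz V).symm.toContinuousLinearEquiv : (V →L[ℝ] ℝ) →L[ℝ] V).compLpL 2 (mu T)
          (-B v (val (G u))), (0 : H)) := by
      rw [hJ', map_neg, ← WithLp.toLp_neg, Prod.neg_mk, neg_zero]
    have k : parabolicOp val dt τ (A + B u) z = -(J (B v) (G u)) ↔ z = fderiv ℝ G u v := by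
      rw [hJ]
      exact (hG' u).2 v z
    exact parabolicOp_eq_iff.symm.trans ((Eq.congr_right e).symm.trans k)

end Perturbation

/-! ### Weak formulations as operator equations -/

section Solutions

variable {N : ℕ} {l : Fin N → ℝ} {T : ℝ}

/-- `τ` reads off the value at `0` of any continuous representative; the converse needs the
embedding theorem to supply one. -/
theorem hasInitialValue_iff (hl : ∀ i, 0 < l i) (hT : 0 < T) {τ : WW l T →L[ℝ] LL2 l}
    (hτ : ∀ w r, IsRep (toL2 l) (WW.valL l T w) r → r 0 = τ w) (ρ : WW l T) (ρ0 : LL2 l) :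
    HasInitialValue ρ ρ0 ↔ τ ρ = ρ0 := by
  have := completeSpace_VV hl
  constructor
  · rintro ⟨r, hr, hr', h0⟩
    rw [← hτ ρ r ⟨hr, hr'⟩, h0]
  · rintro rfl
    obtain ⟨r, hr, -⟩ := ρ.isTimeDeriv.exists_isRep (injective_toL2 l) hT
    exact ⟨r, hr.1, hr.2, hτ ρ r hr⟩

variable {D : Fin N → ℝ} {A : LLinf l T → Lp (VV l) 2 (mu T) →L[ℝ] Lp (VVdual l) 2 (mu T)}

theorem ae_eq_form (hA : ∀ u f, ∀ᵐ t ∂(mu T), A u f t = (diffusionForm l D + driftForm u t) (f t))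
    (u : LLinf l T) (ρ : WW l T) :
    ∀ᵐ t ∂(mu T), ∀ φ, A u (WW.valL l T ρ) t φ = form D u t (ρ.val t) φ := by
  filter_upwards [hA u (WW.valL l T ρ), form_ae_eq D u] with t h1 h2 φ
  rw [h1, h2]
  rfl

/-- The distributional formulation is an equation in `L²(0, T; 𝕍*)`. -/
theorem isWeakSolution_iff
    (hA : ∀ u f, ∀ᵐ t ∂(mu T), A u f t = (diffusionForm l D + driftForm u t) (f t))
    (u : LLinf l T) (ρ0 : LL2 l) (ρ : WW l T) :
    IsWeakSolution D u 0 ρ0 ρ ↔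
      WW.dtL l T ρ + A u (WW.valL l T ρ) = 0 ∧ HasInitialValue ρ ρ0 := by
  -- Testing the `𝕍*`-valued equation with `η` and evaluating at `φ` gives the scalar distributional
  -- formulation; the time derivative is moved onto `η`, and integration commutes with evaluation at
  -- `φ`.
  have key : ∀ φ η, IsTest T η →
      (∫ t, η t • (WW.dtL l T ρ + A u (WW.valL l T ρ) : Lp (VVdual l) 2 (mu T)) t ∂(mu T)) φ =
      -(∫ t, deriv η t * inner ℝ (toL2 l (WW.val ρ t)) (toL2 l φ) ∂(mu T))
        + ∫ t, η t * form D u t (WW.val ρ t) φ ∂(mu T) := by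
    intro φ η hη
    have i1 := integrable_smul_of_compact hη.1.continuous hη.2.1 (WW.dtL l T ρ)
    have i2 := integrable_smul_of_compact hη.1.continuous hη.2.1 (A u (WW.valL l T ρ))
    have i3 : Integrable (fun t => deriv η t • gelfand (toL2 l) (WW.valL l T ρ t)) (mu T) :=
      IsTest.integrable_smul hη.continuous_deriv hη.2.1.deriv
        ((gelfand (toL2 l)).integrable_comp (integrable_coeFn (WW.valL l T ρ)))
    have h1 : ∫ t, η t • (WW.dtL l T ρ + A u (WW.valL l T ρ) : Lp (VVdual l) 2 (mu T)) t ∂(mu T) =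
        (∫ t, η t • WW.dtL l T ρ t ∂(mu T)) + ∫ t, η t • A u (WW.valL l T ρ) t ∂(mu T) := by
      rw [← integral_add i1 i2]
      refine integral_congr_ae ?_
      filter_upwards [Lp.coeFn_add (WW.dtL l T ρ) (A u (WW.valL l T ρ))] with t ht
      rw [ht, Pi.add_apply, smul_add]
    have h2 : ∫ t, η t • WW.dtL l T ρ t ∂(mu T) =
        -∫ t, deriv η t • gelfand (toL2 l) (WW.valL l T ρ t) ∂(mu T) := by
      rw [ρ.isTimeDeriv η hη, neg_neg]
    rw [h1, add_apply, h2, neg_apply, ContinuousLinearMap.integral_apply i3,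
      ContinuousLinearMap.integral_apply i2]
    congr 1
    refine integral_congr_ae ?_
    filter_upwards [ae_eq_form hA u ρ] with t ht
    rw [smul_apply, ht, smul_eq_mul]
  refine and_congr_left fun _ => ⟨fun h => ?_, fun h φ η hη => ?_⟩
  · refine (Lp.eq_zero_iff_ae_eq_zero).2 (ae_eq_zero_of_integral_isTest_smul
      (integrable_coeFn _) fun η hη => ContinuousLinearMap.ext fun φ => ?_)
    rw [key φ η hη, h φ η hη, zero_apply]
    refine integral_eq_zero_of_ae ?_
    filter_upwards [Lp.coeFn_zero (VVdual l) 2 (mu T)] with t ht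
    rw [ht]
    simp
  · rw [← key φ η hη, h]
    have h0 := Lp.coeFn_zero (VVdual l) 2 (mu T)
    rw [integral_eq_zero_of_ae, integral_eq_zero_of_ae, zero_apply]
    · filter_upwards [h0] with t ht
      rw [ht]
      simp
    · filter_upwards [h0] with t ht
      rw [ht]
      simp

/-- Equality in `L²(0, T; 𝕍*)` is equality of functionals at almost every time. The forms agree off
a null set independent of `φ`, which permits the quantifier over `φ` inside the almost-everywhere
statement. -/
theorem isLinearizedSolution_iff
    (hA : ∀ u f, ∀ᵐ t ∂(mu T), A u f t = (diffusionForm l D + driftForm u t) (f t))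
    {B : LLinf l T →L[ℝ] Lp (VV l) 2 (mu T) →L[ℝ] Lp (VVdual l) 2 (mu T)}
    (hB : ∀ u f, ∀ᵐ t ∂(mu T), B u f t = driftForm u t (f t))
    (u v : LLinf l T) (ρ z : WW l T) :
    IsLinearizedSolution D u v ρ z ↔
      WW.dtL l T z + A u (WW.valL l T z) = -B v (WW.valL l T ρ) ∧ HasInitialValue z 0 := by
  have hae : ∀ᵐ t ∂(mu T), (WW.dtL l T z + A u (WW.valL l T z) : Lp (VVdual l) 2 (mu T)) t =
        (-B v (WW.valL l T ρ) : Lp (VVdual l) 2 (mu T)) t ↔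
      ∀ φ : VV l, WW.dt z t φ + form D u t (WW.val z t) φ
        = dFun (fun i x => (WW.val ρ t).comp i x * v i (x, t)) φ := by
    filter_upwards [Lp.coeFn_add (WW.dtL l T z) (A u (WW.valL l T z)),
      Lp.coeFn_neg (B v (WW.valL l T ρ)), ae_eq_form hA u z, hB v (WW.valL l T ρ),
      dFun_ae_eq v] with t h1 h2 h3 h4 h5
    rw [h1, h2, Pi.neg_apply, Pi.add_apply, ContinuousLinearMap.ext_iff]
    refine forall_congr' fun φ => ?_
    rw [add_apply, neg_apply, h3, h4, h5]
    rfl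
  refine and_congr_left fun _ => ⟨fun h => Lp.ext ?_, fun h => ?_⟩
  · filter_upwards [h, hae] with t h1 h2
    exact h2.2 h1
  · filter_upwards [hae] with t ht
    exact ht.1 (by rw [h])

end Solutions

end StarGraph

end

/-! ### The control-to-state map on the star graph -/

theorem proposition4p4 {N : ℕ} (l : Fin N → ℝ) (hl : ∀ i, 0 < l i) (T : ℝ) (hT : 0 < T)
    (D : Fin N → ℝ) (hD : ∀ i, 0 < D i) (ρ0 : StarGraph.LL2 l) :
    ∃ G : StarGraph.LLinf l T → StarGraph.WW l T,
      (∀ u ρ, StarGraph.IsWeakSolution D u 0 ρ0 ρ ↔ ρ = G u) ∧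
      ∀ u, DifferentiableAt ℝ G u ∧
        ∀ v, StarGraph.IsLinearizedSolution D u v (G u) (fderiv ℝ G u v) ∧
          ∀ z, StarGraph.IsLinearizedSolution D u v (G u) z → z = fderiv ℝ G u v := by
  have := StarGraph.completeSpace_VV hl
  have := StarGraph.completeSpace_WW hl T
  -- `d` is the smallest diffusion coefficient; without edges any positive number serves.
  obtain ⟨d, hd, hdD⟩ : ∃ d : ℝ, 0 < d ∧ ∀ i, d ≤ D i := by
    rcases isEmpty_or_nonempty (Fin N) with h | h
    · exact ⟨1, one_pos, fun i => h.elim i⟩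
    · obtain ⟨i, hi⟩ := Finite.exists_min D
      exact ⟨D i, hD i, hi⟩
  have hι := StarGraph.injective_toL2 l
  obtain ⟨τ, hτ⟩ := StarGraph.exists_initialValue hι hT (StarGraph.WW.valL l T)
    (StarGraph.WW.dtL l T) fun w => w.isTimeDeriv
  obtain ⟨B, hB⟩ := StarGraph.exists_driftOp hl T
  let A₀ : Lp (StarGraph.VV l) 2 (StarGraph.mu T) →L[ℝ]
      Lp (StarGraph.VVdual l) 2 (StarGraph.mu T) :=
    (StarGraph.diffusionForm l D).compLpL 2 (StarGraph.mu T)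
  have hA : ∀ u f, ∀ᵐ t ∂(StarGraph.mu T), (A₀ + B u) f t =
      (StarGraph.diffusionForm l D + StarGraph.driftForm u t) (f t) := fun u f => by
    filter_upwards [hB u f, (StarGraph.diffusionForm l D).coeFn_compLpL (p := 2) f,
      Lp.coeFn_add (A₀ f) (B u f)] with t h1 h2 h3
    rw [add_apply, h3, Pi.add_apply, h1, h2, add_apply]
  -- The coercivity constants are `d / 2` and `‖u‖² / (2 d) + d / 2`. They depend on `u` but not on
  -- `t`, and bijectivity is needed only for each `u` separately.
  have hbij : ∀ u, Function.Bijective (StarGraph.parabolicOp (StarGraph.WW.valL l T)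
      (StarGraph.WW.dtL l T) τ (A₀ + B u)) := fun u => by
    refine StarGraph.bijective_parabolicOp (ι := StarGraph.toL2 l)
      (a := fun t => StarGraph.diffusionForm l D + StarGraph.driftForm u t)
      (C := ‖StarGraph.diffusionForm l D‖ + ‖u‖) hι
      (StarGraph.eq_zero_of_inner_toL2 hl) hT (half_pos hd) ?_
      (StarGraph.garding hd hdD u) (fun x y => ?_)
      (StarGraph.norm_diffusionForm_add_driftForm_le D u) (hA u)
      (fun w => w.isTimeDeriv) (fun f g h => StarGraph.WW.exists_of_isTimeDeriv h)
      StarGraph.WW.norm_sq hτ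
    · positivity
    · simp only [add_apply]
      exact (StarGraph.measurable_driftForm u x y).const_add _
  obtain ⟨G, hG, hG'⟩ := StarGraph.exists_controlToState A₀ B hbij ρ0
  have hlin : ∀ u v z, StarGraph.IsLinearizedSolution D u v (G u) z ↔ z = fderiv ℝ G u v :=
    fun u v z => (StarGraph.isLinearizedSolution_iff (A := fun u => A₀ + B u) hA hB u v _ z).trans
      ((and_congr_right fun _ => StarGraph.hasInitialValue_iff hl hT hτ z 0).trans
        ((hG' u).2 v z))
  exact ⟨G, fun u ρ => (StarGraph.isWeakSolution_iff (A := fun u => A₀ + B u) hA u ρ0 ρ).trans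
      ((and_congr_right fun _ => StarGraph.hasInitialValue_iff hl hT hτ ρ ρ0).trans (hG u ρ)),
    fun u => ⟨(hG' u).1, fun v => ⟨(hlin u v _).2 rfl, fun z => (hlin u v z).1⟩⟩⟩
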